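/- A \emph{planning problem} $\mathcal P=\langle\langle \mathcal S,\mathcal A,\mathcal O,\Delta,\Omega\rangle,s_0,\mathcal G\rangle$ consists of finite sets of states, actions and observations, a stochastic transition function $\Delta:\mathcal S\times\mathcal A\to\Pi(\mathcal S)$ ($\Pi(\mathcal S)$ the probability distributions on $\mathcal S$), an observation function $\Omega:\mathcal S\to\mathcal O$, an initial state $s_0$ and a set of goal states $\mathcal G\subseteq\mathcal S$. A \emph{finite state controller} (FSC) $C$ has a finite set $Q$ of controller states with an initial state $q_0$, and two partial functions $\gamma:Q\times\mathcal O\to\mathcal A\cup\{\mathtt{stop}\}$ and $\delta:Q\times\mathcal O\to Q$; it is \emph{$N$-bounded} if $|Q|\le N$. A \emph{history} is a finite sequence $\langle q^{(t)},s^{(t)}\rangle_{t=0}^T$ with $q^{(0)}=q_0$, $s^{(0)}=s_0$ and, for all $t<T$, $a^{(t)}=\gamma(q^{(t)},\Omega(s^{(t)}))\in\mathcal A$, $q^{(t+1)}=\delta(q^{(t)},\Omega(s^{(t)}))$ and $\Delta(s^{(t+1)}\mid s^{(t)},a^{(t)})>0$; its likelihood is $\prod_{t<T}\Delta(s^{(t+1)}\mid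 s^{(t)},a^{(t)})$. It is a \emph{goal history} if $\gamma(q^{(T)},\Omega(s^{(T)}))=\mathtt{stop}$ and $s^{(T)}\in\mathcal G$. $\mathbf{LGT}(C)$ is the sum of the likelihoods of all goal histories. The algorithm \textsc{Pandor} takes $\mathcal P$, an integer $N\ge1$ and $\mathit{LGT}^\star\in(0,1)$. It is a backtracking AND-OR search. It starts with the empty controller on the states $\{0,\dots,N-1\}$ and simulates its runs depth first. Let $h=\langle h^{(0)},\dots,h^{(n-1)}\rangle$ be the current history, and $p^{(k)}$ the probability of the move to $h^{(k)}$ (with $p^{(0)}=1$). The algorithm maintains numbers $\alpha_{\mathrm{goal}}^{(k)},\alpha_{\mathrm{fail}}^{(k)},\alpha_{\mathrm{noter}}^{(k)}$ $(0\le k\le n)$ and $\alpha_{\mathrm{loop}}^{(k,m)}$ $(0\le k\le m<n)$, initially $0$. \emph{OR-step}, for a combined state $\langle q,s\rangle$ reached from the end of $h$ with probability $p$. (i) If $\langle q,s\rangle=h^{(k)}$ for some $k$, add $p$ to $\alpha_{\mathrm{loop}}^{(k,n-1)}$ if the likelihood $p\prod_{j=k+1}^{n-1}p^{(j)}$ of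 the loop is less than $1$, and to $\alpha_{\mathrm{noter}}^{(n)}$ otherwise. (ii) Otherwise, if $C$ has no transition for $(q,\Omega(s))$, choose non-deterministically an element of $\mathcal A\cup\{\mathtt{stop}\}$ and a next controller state and add them to $C$. If the transition is now $\mathtt{stop}$, add $p$ to $\alpha_{\mathrm{goal}}^{(n)}$ if $s\in\mathcal G$ and to $\alpha_{\mathrm{fail}}^{(n)}$ if not. If it is an action $a$ with next controller state $q'$, append $\langle q,s\rangle$ to $h$, extend the $\alpha$'s by zeros, and make an AND-step with $q'$ and the states $s'$ with $\Delta(s'\mid s,a)>0$. \emph{AND-step.} For each given next state in turn, make an OR-step and then compute $\lambda_{\mathrm{goal}}^{(0)},\lambda_{\mathrm{fail}}^{(0)},\lambda_{\mathrm{noter}}^{(0)}$. If $\lambda_{\mathrm{goal}}^{(0)}\ge\mathit{LGT}^\star$, the whole search returns $C$. Otherwise, if $1-\lambda_{\mathrm{fail}}^{(0)}-\lambda_{\mathrm{noter}}^{(0)}<\mathit{LGT}^\star$, the branch fails and the search backtracks to the last choice that has an untried alternative. When all next states are done and $h$ is not empty, its last element, with index $m=n-1$, is removed and the $\alpha$'s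 are rolled up: $\alpha_\bullet^{(m)}$ is increased by $p^{(m)}\alpha_\bullet^{(m+1)}/(1-\alpha_{\mathrm{loop}}^{(m,m)})$ for $\bullet\in\{\mathrm{goal},\mathrm{fail},\mathrm{noter}\}$, and $\alpha_{\mathrm{loop}}^{(k,m-1)}$ by $p^{(m)}\alpha_{\mathrm{loop}}^{(k,m)}/(1-\alpha_{\mathrm{loop}}^{(m,m)})$ for $k<m$; but if $\alpha_{\mathrm{loop}}^{(m,m)}+\alpha_{\mathrm{noter}}^{(m+1)}=1$, then $\alpha_{\mathrm{noter}}^{(m)}$ is increased by $p^{(m)}$, and in the other formulas $\alpha_{\mathrm{loop}}^{(m,m)}$ in the denominator is replaced by $0$. \emph{The values $\lambda$.} Set $\lambda_\bullet^{(n)}=\alpha_\bullet^{(n)}$ and, for $k=n-1,\dots,0$, $$\lambda_{\mathrm{loop}}^{(k)}=\alpha_{\mathrm{loop}}^{(k,k)}+\sum_{m=k+1}^{n-1}\Bigl(\prod_{j=k+1}^{m}\frac{p^{(j)}}{1-\lambda_{\mathrm{loop}}^{(j)}}\Bigr)\alpha_{\mathrm{loop}}^{(k,m)},\qquad \lambda_\bullet^{(k)}=\frac{p^{(k)}\lambda_\bullet^{(k+1)}}{1-\lambda_{\mathrm{loop}}^{(k)}}+\alpha_\bullet^{(k)};$$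 but if $\lambda_{\mathrm{loop}}^{(k)}+\lambda_{\mathrm{noter}}^{(k+1)}=1$ (no run from $h^{(k)}$ terminates), then $\lambda_{\mathrm{loop}}^{(j)}$ is reset to $0$ for all $j\ge k$ and $\lambda_{\mathrm{noter}}^{(k)}=p^{(k)}+\alpha_{\mathrm{noter}}^{(k)}$. The search begins with an AND-step with controller state $0$, empty history and the single next state $s_0$, of probability $1$. \textbf{Theorem.} For every finite planning problem $\mathcal P$, integer $N\ge1$ and $\mathit{LGT}^\star\in(0,1)$, and for every order in which the search goes through next states and non-deterministic choices, \textsc{Pandor} terminates and is sound and complete: every FSC $C$ that it returns is $N$-bounded and has $\mathbf{LGT}(C)\ge\mathit{LGT}^\star$; and if there is an $N$-bounded FSC with $\mathbf{LGT}\ge\mathit{LGT}^\star$, then the search returns one such FSC. -/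

import Mathlib

noncomputable section

open scoped ENNReal

/-! ### Environments, planning problems, controllers -/

/-- An environment with states `S`, actions `A`, observations `O`: a stochastic state transition
function and an observation function. -/
structure Environment (S A O : Type*) where
  Δ : S → A → PMF S
  Ω : S → O

/-- A planning problem: an environment, an initial state and a set of goal states. -/
structure PlanningProblem (S A O : Type*) where
  env : Environment S A O
  s₀ : S
  goals : Set S

/-- What a controller may execute: an action of the environment, or the special action
`stop` (the constructor `halt`). -/
inductive ControlAction (A : Type*) where
  | act (a : A) : ControlAction A
  | halt : ControlAction A

/-- A finite state controller with states `q₀, …, q_{numStates - 1}`; the labeling function `γ` and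
the transition function `δ` are partial. -/
structure FSC (A O : Type*) where
  numStates : ℕ
  numStates_pos : 0 < numStates
  γ : Fin numStates → O → Option (ControlAction A)
  δ : Fin numStates → O → Option (Fin numStates)

namespace FSC

variable {S A O : Type*}

/-- The initial controller state. -/
def q₀ (C : FSC A O) : Fin C.numStates := ⟨0, C.numStates_pos⟩

/-- The controller has at most `N` states. -/
def IsBounded (C : FSC A O) (N : ℕ) : Prop := C.numStates ≤ N

/-- Combined states of the system formed by an environment with states `S` and the controller. -/
abbrev Combined (C : FSC A O) (S : Type*) : Type _ := Fin C.numStates × S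

/-- One step of the system: the controller executes the action `γ(q, Ω(s))`, which is not `stop`,
moves to `δ(q, Ω(s))`, and the environment responds with a state of positive probability. -/
def Step (C : FSC A O) (E : Environment S A O) (c c' : C.Combined S) : Prop :=
  ∃ a, C.γ c.1 (E.Ω c.2) = some (.act a) ∧ C.δ c.1 (E.Ω c.2) = some c'.1 ∧ 0 < E.Δ c.2 a c'.2

/-- A history of the system, started in the initial combined state. -/
def IsHistory (C : FSC A O) (P : PlanningProblem S A O) (h : List (C.Combined S)) : Prop :=
  h.head? = some (C.q₀, P.s₀) ∧ h.IsChain (C.Step P.env)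

/-- A goal history: a history at whose end the controller executes `stop` in a goal state. -/
def IsGoalHistory (C : FSC A O) (P : PlanningProblem S A O) (h : List (C.Combined S)) : Prop :=
  C.IsHistory P h ∧
    ∃ c, h.getLast? = some c ∧ C.γ c.1 (P.env.Ω c.2) = some .halt ∧ c.2 ∈ P.goals

/-- The probability with which the environment responds, in the combined state `c`, to the action
of the controller by moving to the state `s'`. -/
def responseProb (C : FSC A O) (E : Environment S A O) (c : C.Combined S) (s' : S) : ℝ≥0∞ :=
  match C.γ c.1 (E.Ω c.2) with
  | some (.act a) => E.Δ c.2 a s'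
  | _ => 0

/-- The likelihood of a history. -/
def likelihood (C : FSC A O) (E : Environment S A O) : List (C.Combined S) → ℝ≥0∞
  | [] => 1
  | [_] => 1
  | c :: c' :: h => C.responseProb E c c'.2 * C.likelihood E (c' :: h)

/-- The total likelihood of goal termination: the sum of the likelihoods of all goal histories. -/
def LGT (C : FSC A O) (P : PlanningProblem S A O) : ℝ≥0∞ :=
  ∑' h : {h : List (C.Combined S) // C.IsGoalHistory P h}, C.likelihood P.env h.1

end FSC

/-! ### The search algorithm PANDOR -/

namespace Pandor

variable {S A O : Type*} {N : ℕ}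

/-- A controller under construction: a finite set of transitions `q --o/a--> q'` between the
controller states `0, …, N - 1`, at most one for each pair `(q, o)`. -/
abbrev Ctrl (A O : Type*) (N : ℕ) : Type _ := Fin N → O → Option (ControlAction A × Fin N)

/-- The finite state controller given by a set of transitions. -/
def Ctrl.toFSC (C : Ctrl A O N) (hN : 0 < N) : FSC A O where
  numStates := N
  numStates_pos := hN
  γ q o := (C q o).map Prod.fst
  δ q o := (C q o).map Prod.snd

/-- The empty controller. -/
def Ctrl.empty : Ctrl A O N := fun _ _ => none

open Classical in
/-- The controller extended by the transition `q --o/x.1--> x.2`. -/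
def Ctrl.extend (C : Ctrl A O N) (q : Fin N) (o : O) (x : ControlAction A × Fin N) : Ctrl A O N :=
  fun q' o' => if q' = q ∧ o' = o then some x else C q' o'

/-- The history `h_curr` that is currently simulated: the combined states `h⁽⁰⁾, h⁽¹⁾, …`, each with
the probability `p⁽ᵏ⁾` of the move from `h⁽ᵏ⁻¹⁾` to `h⁽ᵏ⁾` (and `p⁽⁰⁾ = 1`). -/
abbrev Hist (S : Type*) (N : ℕ) : Type _ := List ((Fin N × S) × ℝ)

/-- The probability `p⁽ᵏ⁾` of the `k`-th move of the current history. -/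
def Hist.p (h : Hist S N) (k : ℕ) : ℝ := (h.map Prod.snd).getD k 0

/-- The combined states that occur in the current history. -/
def Hist.states (h : Hist S N) : List (Fin N × S) := h.map Prod.fst

/-- The bookkeeping of the search. With a current history of length `n`, the vectors have the
entries `0, …, n`, and the matrix has rows and columns `0, …, n - 1`; other entries are never read.

* `goal k`, `fail k`, `noter k`: likelihood of the runs visited so far that leave the current
  history just after its first `k` elements, repeat none of these, and terminate in a goal state,
  terminate in another state, or are known never to terminate, conditional on these `k` elements.
* `loop k m`: likelihood of the visited runs that, after `h⁽⁰⁾, …, h⁽ᵐ⁾`, leave the current history,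
  repeat none of `h⁽⁰⁾, …, h⁽ᵐ⁾`, and then return to `h⁽ᵏ⁾` (`k ≤ m`), conditional on
  `h⁽⁰⁾, …, h⁽ᵐ⁾`. -/
structure Alpha where
  goal : ℕ → ℝ
  fail : ℕ → ℝ
  noter : ℕ → ℝ
  loop : ℕ → ℕ → ℝ

/-- Nothing has been visited yet. -/
def Alpha.zero : Alpha := ⟨fun _ => 0, fun _ => 0, fun _ => 0, fun _ _ => 0⟩

/-- When a history of length `n` is extended by one element, each vector gets an additional zero
entry, the matrix an additional row and column of zeros. -/
def Alpha.push (α : Alpha) (n : ℕ) : Alpha where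
  goal := Function.update α.goal (n + 1) 0
  fail := Function.update α.fail (n + 1) 0
  noter := Function.update α.noter (n + 1) 0
  loop k m := if k = n ∨ m = n then 0 else α.loop k m

/-- The values `λ_goal⁽ᵏ⁾, λ_fail⁽ᵏ⁾, λ_noter⁽ᵏ⁾` for one `k`, with `λ_loop⁽ʲ⁾` for all `j ≥ k`. -/
structure Lambda where
  goal : ℝ
  fail : ℝ
  noter : ℝ
  loop : ℕ → ℝ

/-- `λ_loop⁽ᵏ⁾` from the values `L j = λ_loop⁽ʲ⁾` for `k < j < n`: loop to `h⁽ᵏ⁾` directly, or follow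
the current history up to some `h⁽ᵐ⁾`, where each `h⁽ʲ⁾`, `k < j ≤ m`, can be repeated any number of
times, before looping back to `h⁽ᵏ⁾`. -/
def lambdaLoop (p : ℕ → ℝ) (α : Alpha) (L : ℕ → ℝ) (n k : ℕ) : ℝ :=
  α.loop k k +
    ∑ m ∈ Finset.Ioo k n, (∏ j ∈ Finset.Ioc k m, p j * (1 - L j)⁻¹) * α.loop k m

open Classical in
/-- The loop `for k = n - 1, …, 0` that computes the `λ` values for a history of length `n`,
stopped after `d` rounds, that is, at `k = n - d`. If no run from `h⁽ᵏ⁾` terminates, the loop entries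
from `k` on are zeroed out, and the move to `h⁽ᵏ⁾` counts as non-terminating with its whole
probability `p⁽ᵏ⁾`. -/
def lambdaAfter (p : ℕ → ℝ) (α : Alpha) (n : ℕ) : ℕ → Lambda
  | 0 => ⟨α.goal n, α.fail n, α.noter n, fun _ => 0⟩
  | d + 1 =>
    let k := n - (d + 1)
    let prev := lambdaAfter p α n d
    let l := lambdaLoop p α prev.loop n k
    if l + prev.noter = 1 then
      { goal := p k * prev.goal + α.goal k
        fail := p k * prev.fail + α.fail k
        noter := p k + α.noter k
        loop := fun _ => 0 }
    else
      { goal := p k * prev.goal / (1 - l) + α.goal k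
        fail := p k * prev.fail / (1 - l) + α.fail k
        noter := p k * prev.noter / (1 - l) + α.noter k
        loop := Function.update prev.loop k l }

/-- `CalcLambda`: the values `λ_goal⁽⁰⁾`, `λ_fail⁽⁰⁾`, `λ_noter⁽⁰⁾` of the current history. -/
def calcLambda (h : Hist S N) (α : Alpha) : Lambda := lambdaAfter h.p α h.length h.length

open Classical in
/-- `CumulateAlpha`: before the last element `h⁽ᵐ⁾` of the current history is removed, the last
entries of the vectors and the last row and column of the matrix are integrated into the previous
ones (at the root there is nothing to remove). -/
def cumulateAlpha (h : Hist S N) (α : Alpha) : Alpha :=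
  match h.length with
  | 0 => α
  | m + 1 =>
    if α.loop m m + α.noter (m + 1) = 1 then
      { goal := Function.update α.goal m (h.p m * α.goal (m + 1) + α.goal m)
        fail := Function.update α.fail m (h.p m * α.fail (m + 1) + α.fail m)
        noter := Function.update α.noter m (h.p m + α.noter m)
        loop := fun k j =>
          if k < m ∧ j + 1 = m then h.p m * α.loop k m + α.loop k j else α.loop k j }
    else
      { goal := Function.update α.goal m
          (h.p m * α.goal (m + 1) / (1 - α.loop m m) + α.goal m)
        fail := Function.update α.fail m
          (h.p m * α.fail (m + 1) / (1 - α.loop m m) + α.fail m)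
        noter := Function.update α.noter m
          (h.p m * α.noter (m + 1) / (1 - α.loop m m) + α.noter m)
        loop := fun k j =>
          if k < m ∧ j + 1 = m then h.p m * α.loop k m / (1 - α.loop m m) + α.loop k j
          else α.loop k j }

open Classical in
/-- The bookkeeping when the next combined state, reached with probability `p`, equals `h⁽ᵏ⁾`: a
decaying loop is recorded as a loop, a loop of likelihood 1 as a run that never terminates. -/
def Alpha.addLoop (α : Alpha) (h : Hist S N) (k : ℕ) (p : ℝ) : Alpha :=
  if (∏ j ∈ Finset.Ioo k h.length, h.p j) * p < 1 then
    { α with loop := fun i m =>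
        if i = k ∧ m + 1 = h.length then α.loop i m + p else α.loop i m }
  else
    { α with noter := Function.update α.noter h.length (α.noter h.length + p) }

open Classical in
/-- The bookkeeping when the controller stops in `s`, reached with probability `p`. -/
def Alpha.addStop (α : Alpha) (P : PlanningProblem S A O) (h : Hist S N) (s : S) (p : ℝ) : Alpha :=
  if s ∈ P.goals then
    { α with goal := Function.update α.goal h.length (α.goal h.length + p) }
  else
    { α with fail := Function.update α.fail h.length (α.fail h.length + p) }

/-- The order of the search: `outcomes s a` lists the possible next states without repetition, and
`choices C q o` lists all candidates for a new transition of the controller `C` at `(q, o)`. -/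
structure SearchOrder (P : PlanningProblem S A O) (N : ℕ) where
  outcomes : S → A → List S
  outcomes_nodup : ∀ s a, (outcomes s a).Nodup
  mem_outcomes : ∀ s a s', s' ∈ outcomes s a ↔ 0 < P.env.Δ s a s'
  choices : Ctrl A O N → Fin N → O → List (ControlAction A × Fin N)
  mem_choices : ∀ C q o x, x ∈ choices C q o

/-- A search order exists. -/
theorem SearchOrder.nonempty [Fintype S] [Fintype A] (P : PlanningProblem S A O) (N : ℕ) :
    Nonempty (SearchOrder P N) := by
  classical
  refine ⟨⟨fun s a => (Finset.univ.filter fun s' => 0 < P.env.Δ s a s').toList,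
    fun s a => Finset.nodup_toList _, fun s a s' => by simp,
    fun _ _ _ => (ControlAction.halt :: (Finset.univ : Finset A).toList.map ControlAction.act) ×ˢ
      List.finRange N, ?_⟩⟩
  rintro C q o ⟨x, q'⟩
  rw [List.mem_product]
  cases x <;> simp

/-- How one non-deterministic branch of a step ends, unless it fails: the whole search returns a
controller, or the step is completed, with the current controller and bookkeeping. -/
inductive Outcome (A O : Type*) (N : ℕ) where
  | success (C : Ctrl A O N) : Outcome A O N
  | done (C : Ctrl A O N) (α : Alpha) : Outcome A O N

open Classical in
/-- The number of combined states that do not occur in the current history. -/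
def unvisited [Fintype S] (h : Hist S N) : ℕ :=
  (Finset.univ.filter fun c : Fin N × S => c ∉ h.states).card

theorem unvisited_append_lt [Fintype S] (h : Hist S N) (c : Fin N × S) (p : ℝ)
    (hc : c ∉ h.states) : unvisited (h ++ [(c, p)]) < unvisited h := by
  classical
  apply Finset.card_lt_card
  rw [Finset.ssubset_iff_of_subset]
  · exact ⟨c, by simpa using hc, by simp [Hist.states]⟩
  · intro x hx
    have hx := (Finset.mem_filter.1 hx).2
    simp only [Hist.states, List.map_append, List.mem_append, not_or] at hx
    exact Finset.mem_filter.2 ⟨Finset.mem_univ _, hx.1⟩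

/-- The next states of the environment, in the order of the search, with their probabilities. -/
def nextStates {P : PlanningProblem S A O} (ord : SearchOrder P N) (s : S) (a : A) :
    List (S × ℝ) :=
  (ord.outcomes s a).map fun s' => (s', (P.env.Δ s a s').toReal)

/- The two mutually recursive steps are non-deterministic and backtracking. Each returns the list of
its branches that do not fail, in the order in which backtracking meets them. -/
open Classical in
mutual

/-- The AND-step: in controller state `q`, after the current history `h`, simulate the possible next
states `next`, each with its probability, one after the other. After each of them, return the
controller if the lower bound `λ_goal` on its likelihood of goal termination is at least `LGTstar`,
and fail this branch if the upper bound `1 - λ_fail - λ_noter` is below `LGTstar`. -/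
def andStep [Fintype S] (P : PlanningProblem S A O) (ord : SearchOrder P N) (LGTstar : ℝ)
    (C : Ctrl A O N) (q : Fin N) (next : List (S × ℝ)) (h : Hist S N) (α : Alpha) :
    List (Outcome A O N) :=
  match next with
  | [] => [.done C (cumulateAlpha h α)]
  | (s, p) :: rest =>
    (orStep P ord LGTstar C q s p h α).flatMap fun r =>
      match r with
      | .success C' => [.success C']
      | .done C' α' =>
        let lam := calcLambda h α'
        if LGTstar ≤ lam.goal then [.success C']
        else if 1 - lam.fail - lam.noter < LGTstar then []
        else andStep P ord LGTstar C' q rest h α'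
  termination_by (unvisited h, next.length + 1)

/-- The OR-step: in the combined state `(q, s)`, reached with probability `p` after the current
history `h`, record a loop or a termination; otherwise execute the action of the controller, which is
chosen non-deterministically, together with the next controller state, if it is undefined. -/
def orStep [Fintype S] (P : PlanningProblem S A O) (ord : SearchOrder P N) (LGTstar : ℝ)
    (C : Ctrl A O N) (q : Fin N) (s : S) (p : ℝ) (h : Hist S N) (α : Alpha) :
    List (Outcome A O N) :=
  if (q, s) ∈ h.states then
    [.done C (α.addLoop h (h.states.idxOf (q, s)) p)]
  else
    match C q (P.env.Ω s) with
    | some (.halt, _) => [.done C (α.addStop P h s p)]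
    | some (.act a, q') =>
      andStep P ord LGTstar C q' (nextStates ord s a) (h ++ [((q, s), p)]) (α.push h.length)
    | none =>
      (ord.choices C q (P.env.Ω s)).flatMap fun x =>
        match x with
        | (.halt, q') =>
          [.done (C.extend q (P.env.Ω s) (.halt, q')) (α.addStop P h s p)]
        | (.act a, q') =>
          andStep P ord LGTstar (C.extend q (P.env.Ω s) (.act a, q')) q' (nextStates ord s a)
            (h ++ [((q, s), p)]) (α.push h.length)
  termination_by (unvisited h, 0)
  decreasing_by
    all_goals exact Prod.Lex.left _ _ (unvisited_append_lt _ _ _ ‹_›)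

end

/-- The search: start with the empty controller in its initial state, the empty history and the
initial state of the environment, and return the controller of the first successful branch, if there
is one. -/
def synth [Fintype S] (P : PlanningProblem S A O) (N : ℕ) (hN : 0 < N) (LGTstar : ℝ)
    (ord : SearchOrder P N) : Option (FSC A O) :=
  (andStep P ord LGTstar Ctrl.empty ⟨0, hN⟩ [(P.s₀, 1)] [] Alpha.zero).findSome? fun r =>
    match r with
    | .success C => some (C.toFSC hN)
    | .done _ _ => none

end Pandor

end

-- Recursion on the number of unvisited combined states makes the search terminate by definition;
-- soundness and completeness remain. Both follow from a family of linear inequalities that the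
-- search preserves.
--
-- Assign a value `w` to each of the three ways in which a run can end, and let `f` be a
-- superharmonic function on the combined states that dominates these values at stopping states
-- (`IsBound`). At each level of the history, the recorded outcomes, the recorded loops, the next
-- element of the history and the states still pending, weighted by probabilities and valued by `w`
-- and `f`, sum up to at most the value of that element (`Alpha.Bounded`). Removing the last element
-- solves its inequality for its own value and substitutes the result one level below.
-- `cumulateAlpha` does exactly this (`Bounded.pop`), and the λ's are what remains when all elements
-- are removed (`Valid.popRel`). Hence the value of the λ's is at most `f` at the initial state
-- (`Valid.lambda_le`).
--
-- Two choices of `f` give the two bounds. The likelihood of goal termination, with value 1 for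
-- goals only, shows that `λ_goal` is a lower bound. The other is one minus this likelihood, with
-- value 1 for failure and non-termination. A harmonic inequality alone says nothing on a closed
-- loop, so the likelihood is discounted by `β < 1`. The discount gives a strict decrease, of size
-- `ε * max 0 (w.noter - f)`, which forces `f` to be at least `w.noter` on runs that never end; `β →
-- 1` then shows that `1 - λ_fail - λ_noter` is an upper bound.
--
-- Soundness is the lower bound. For completeness, make a solution total and follow the branch that
-- always chooses its transitions: its likelihood respects the upper bound, so the branch is never
-- pruned. The invariant `Inv` also records that probability mass is conserved. At the root nothing
-- is pending, so both bounds coincide and the branch succeeds.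

namespace Pandor

/-! ### Elimination of the last element of a history -/

/-- The value given to the three ways in which a run may end. -/
structure Reward where
  goal : ℝ
  fail : ℝ
  noter : ℝ

/-- The total value of the recorded runs that leave the history after its first `k` elements. -/
noncomputable def Alpha.reward (α : Alpha) (w : Reward) (k : ℕ) : ℝ :=
  w.goal * α.goal k + w.fail * α.fail k + w.noter * α.noter k

/-- The value of the recorded runs bounds from below the value `F k` of the `k`-th element of the
history, for each `k < n`, and the value `b` of the initial state. The residue `ρ k` accounts for
the runs that have not been visited yet. -/
structure Alpha.Bounded (α : Alpha) (w : Reward) (ε b : ℝ) (n : ℕ) (p F ρ : ℕ → ℝ) : Prop where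
  root : α.reward w 0 + (if 0 < n then p 0 * F 0 else 0) + ρ 0 ≤ b
  level : ∀ k < n, α.reward w (k + 1) + ∑ i ∈ Finset.range (k + 1), α.loop i k * F i
    + (if k + 1 < n then p (k + 1) * F (k + 1) else 0) + ρ (k + 1)
    + ε * max 0 (w.noter - F k) ≤ F k

/-- The entries that are in use are nonnegative, and the recorded mass is at most `1`. -/
structure Alpha.Valid (α : Alpha) (n : ℕ) (p : ℕ → ℝ) : Prop where
  goal_nonneg : ∀ k ≤ n, 0 ≤ α.goal k
  fail_nonneg : ∀ k ≤ n, 0 ≤ α.fail k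
  noter_nonneg : ∀ k ≤ n, 0 ≤ α.noter k
  loop_nonneg : ∀ i k, i ≤ k → k < n → 0 ≤ α.loop i k
  p_pos : ∀ k < n, 0 < p k
  mass : ∀ k < n, α.goal (k + 1) + α.fail (k + 1) + α.noter (k + 1)
    + ∑ i ∈ Finset.range (k + 1), α.loop i k + (if k + 1 < n then p (k + 1) else 0) ≤ 1

open Classical in
/-- The expected number of visits to the last element `h⁽ᵐ⁾` of the history. -/
noncomputable def Alpha.visits (α : Alpha) (m : ℕ) : ℝ :=
  if α.loop m m + α.noter (m + 1) = 1 then 1 else (1 - α.loop m m)⁻¹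

open Classical in
/-- `cumulateAlpha` for a history of length `m + 1` with move probabilities `p`. -/
noncomputable def Alpha.pop (α : Alpha) (p : ℕ → ℝ) (m : ℕ) : Alpha where
  goal := Function.update α.goal m (p m * (α.visits m * α.goal (m + 1)) + α.goal m)
  fail := Function.update α.fail m (p m * (α.visits m * α.fail (m + 1)) + α.fail m)
  noter := Function.update α.noter m
    (p m * (if α.loop m m + α.noter (m + 1) = 1 then 1 else α.visits m * α.noter (m + 1))
      + α.noter m)
  loop k j :=
    if k < m ∧ j + 1 = m then p m * (α.visits m * α.loop k m) + α.loop k j else α.loop k j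

variable {S : Type*} {N : ℕ}

theorem cumulateAlpha_eq_pop (h : Hist S N) (α : Alpha) {m : ℕ} (hm : h.length = m + 1) :
    cumulateAlpha h α = α.pop h.p m := by
  unfold cumulateAlpha
  rw [hm]
  unfold Alpha.pop Alpha.visits
  dsimp only
  split_ifs
  · simp
  · simp only [div_eq_mul_inv, Alpha.mk.injEq]
    refine ⟨?_, ?_, ?_, ?_⟩
    · congr 1; ring
    · congr 1; ring
    · congr 1; ring
    · funext k j; congr 1; ring

namespace Alpha

variable {α : Alpha} {p : ℕ → ℝ} {m : ℕ}

theorem pop_goal_of_lt {k : ℕ} (hk : k < m) : (α.pop p m).goal k = α.goal k := by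
  simp [pop, Function.update_of_ne hk.ne]

theorem pop_fail_of_lt {k : ℕ} (hk : k < m) : (α.pop p m).fail k = α.fail k := by
  simp [pop, Function.update_of_ne hk.ne]

theorem pop_noter_of_lt {k : ℕ} (hk : k < m) : (α.pop p m).noter k = α.noter k := by
  simp [pop, Function.update_of_ne hk.ne]

theorem pop_reward_of_lt {k : ℕ} (w : Reward) (hk : k < m) :
    (α.pop p m).reward w k = α.reward w k := by
  simp [reward, pop_goal_of_lt hk, pop_fail_of_lt hk, pop_noter_of_lt hk]

theorem pop_loop_of_ne {i k : ℕ} (hk : k + 1 ≠ m) : (α.pop p m).loop i k = α.loop i k := by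
  simp [pop, hk]

theorem pop_loop_succ {i k : ℕ} (hi : i ≤ k) :
    (α.pop p (k + 1)).loop i k
      = p (k + 1) * (α.visits (k + 1) * α.loop i (k + 1)) + α.loop i k :=
  if_pos ⟨Nat.lt_succ_of_le hi, rfl⟩

/-- The loop at `m` and `noter` already exhaust the total mass 1, so every other nonnegative entry
vanishes. -/
theorem Valid.special (hα : α.Valid (m + 1) p) (hs : α.loop m m + α.noter (m + 1) = 1) :
    α.goal (m + 1) = 0 ∧ α.fail (m + 1) = 0 ∧ ∀ i < m, α.loop i m = 0 := by
  have h1 := hα.mass m (Nat.lt_succ_self m)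
  rw [Finset.sum_range_succ, if_neg (lt_irrefl _)] at h1
  have h2 := hα.goal_nonneg (m + 1) le_rfl
  have h3 := hα.fail_nonneg (m + 1) le_rfl
  have h4 : ∀ i ∈ Finset.range m, 0 ≤ α.loop i m := fun i hi =>
    hα.loop_nonneg i m (Finset.mem_range.1 hi).le (Nat.lt_succ_self m)
  have h5 := Finset.sum_nonneg h4
  refine ⟨by linarith, by linarith, fun i hi => ?_⟩
  have h6 : ∑ i ∈ Finset.range m, α.loop i m = 0 := by linarith
  exact (Finset.sum_eq_zero_iff_of_nonneg h4).1 h6 i (Finset.mem_range.2 hi)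

/-- A loop of mass at least 1 would leave no room for `noter`, which is the excluded special case.
This justifies dividing by `1 - α.loop m m`. -/
theorem Valid.loop_lt_one (hα : α.Valid (m + 1) p) (hs : α.loop m m + α.noter (m + 1) ≠ 1) :
    α.loop m m < 1 := by
  have h1 := hα.mass m (Nat.lt_succ_self m)
  rw [Finset.sum_range_succ, if_neg (lt_irrefl _)] at h1
  have h2 := hα.goal_nonneg (m + 1) le_rfl
  have h3 := hα.fail_nonneg (m + 1) le_rfl
  have h4 := hα.noter_nonneg (m + 1) le_rfl
  have h5 : 0 ≤ ∑ i ∈ Finset.range m, α.loop i m := Finset.sum_nonneg fun i hi =>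
    hα.loop_nonneg i m (Finset.mem_range.1 hi).le (Nat.lt_succ_self m)
  rcases lt_or_ge (α.loop m m) 1 with h | h
  · exact h
  · exact absurd (by linarith) hs

theorem Valid.visits_pos (hα : α.Valid (m + 1) p) : 0 < α.visits m := by
  unfold visits
  split_ifs with hs
  · exact one_pos
  · exact inv_pos.2 (sub_pos.2 (hα.loop_lt_one hs))

/-- The value recorded for the last element of the history is at most the value of this element. -/
theorem Valid.pop_le {w : Reward} {ε b : ℝ} {F ρ : ℕ → ℝ} (hα : α.Valid (m + 1) p)
    (hb : α.Bounded w ε b (m + 1) p F ρ) (hε : 0 < ε) (hρ : 0 ≤ ρ (m + 1)) :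
    (α.pop p m).reward w m + p m * ∑ i ∈ Finset.range m, α.visits m * α.loop i m * F i
      ≤ α.reward w m + p m * F m := by
  have h1 := hb.level m (Nat.lt_succ_self m)
  rw [Finset.sum_range_succ, if_neg (lt_irrefl _)] at h1
  have hp := hα.p_pos m (Nat.lt_succ_self m)
  have hmax : 0 ≤ ε * max 0 (w.noter - F m) := mul_nonneg hε.le (le_max_left _ _)
  by_cases hs : α.loop m m + α.noter (m + 1) = 1
  · obtain ⟨hg, hf, hl⟩ := hα.special hs
    have hsum : ∀ c : ℝ, ∑ i ∈ Finset.range m, c * α.loop i m * F i = 0 := fun c =>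
      Finset.sum_eq_zero fun i hi => by rw [hl i (Finset.mem_range.1 hi)]; ring
    have hsum' := hsum 1
    simp only [one_mul] at hsum'
    rw [hsum]
    rw [hsum'] at h1
    -- With `n = α.noter (m + 1)`, the inequality of level `m` reads `n * (w.noter - F m) + ρ (m +
    -- 1) + ε * max 0 (w.noter - F m) ≤ 0`. Since `ε > 0`, this excludes `F m < w.noter`.
    have hF : w.noter ≤ F m := by
      by_contra hlt
      push Not at hlt
      have h2 : 0 ≤ α.noter (m + 1) := hα.noter_nonneg _ le_rfl
      have h3 : w.noter - F m ≤ max 0 (w.noter - F m) := le_max_right _ _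
      have h4 : ε * (w.noter - F m) ≤ ε * max 0 (w.noter - F m) :=
        mul_le_mul_of_nonneg_left h3 hε.le
      have h5 : 0 < ε * (w.noter - F m) := mul_pos hε (sub_pos.2 hlt)
      have h6 : 0 ≤ α.noter (m + 1) * (w.noter - F m) := mul_nonneg h2 (sub_pos.2 hlt).le
      have h7 : α.loop m m = 1 - α.noter (m + 1) := by linarith
      simp only [reward, hg, hf, h7] at h1
      nlinarith
    simp only [reward, pop, Function.update_self, if_pos hs, hg, hf]
    nlinarith [mul_le_mul_of_nonneg_left hF hp.le]
  · have hlt := hα.loop_lt_one hs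
    have hv : α.visits m = (1 - α.loop m m)⁻¹ := by simp [visits, hs]
    have hpos : 0 < 1 - α.loop m m := sub_pos.2 hlt
    -- `F m` occurs on both sides of its own inequality, with coefficient `α.loop m m < 1` on the
    -- left; solving for it produces the geometric factor `visits`.
    have key : α.visits m * (α.reward w (m + 1) + ∑ i ∈ Finset.range m, α.loop i m * F i)
        ≤ F m := by
      rw [hv, inv_mul_le_iff₀ hpos]
      nlinarith
    have hsum : ∑ i ∈ Finset.range m, α.visits m * α.loop i m * F i
        = α.visits m * ∑ i ∈ Finset.range m, α.loop i m * F i := by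
      rw [Finset.mul_sum]
      exact Finset.sum_congr rfl fun i _ => by ring
    have key2 := mul_le_mul_of_nonneg_left key hp.le
    rw [hsum]
    simp only [reward, pop, Function.update_self, if_neg hs] at key2 ⊢
    linarith

/-- Gaussian elimination of the unknown `F m`: it enters the level below only through `p m * F m`,
which `pop_le` replaces by the rolled-up entries. All other levels are untouched. -/
theorem Bounded.pop {w : Reward} {ε b : ℝ} {F ρ : ℕ → ℝ} (hb : α.Bounded w ε b (m + 1) p F ρ)
    (hα : α.Valid (m + 1) p) (hε : 0 < ε) (hρ : 0 ≤ ρ (m + 1)) :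
    (α.pop p m).Bounded w ε b m p F ρ := by
  have h := hα.pop_le hb hε hρ
  constructor
  · rcases Nat.eq_zero_or_pos m with rfl | hm
    · have := hb.root
      simp at h this ⊢
      linarith
    · rw [pop_reward_of_lt w hm, if_pos hm]
      simpa using hb.root
  · intro k hk
    have hl := hb.level k (by omega)
    rw [if_pos (by omega : k + 1 < m + 1)] at hl
    rcases Nat.lt_or_ge (k + 1) m with hkm | hkm
    · rw [pop_reward_of_lt w hkm, if_pos hkm]
      simpa only [pop_loop_of_ne hkm.ne] using hl
    · obtain rfl : m = k + 1 := by omega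
      have hsum : ∑ i ∈ Finset.range (k + 1), (α.pop p (k + 1)).loop i k * F i
          = p (k + 1) * ∑ i ∈ Finset.range (k + 1), α.visits (k + 1) * α.loop i (k + 1) * F i
            + ∑ i ∈ Finset.range (k + 1), α.loop i k * F i := by
        rw [Finset.mul_sum, ← Finset.sum_add_distrib]
        refine Finset.sum_congr rfl fun i hi => ?_
        rw [pop_loop_succ (Nat.lt_succ_iff.1 (Finset.mem_range.1 hi))]
        ring
      rw [hsum, if_neg (lt_irrefl _)]
      linarith

theorem Valid.pop (hα : α.Valid (m + 1) p) : (α.pop p m).Valid m p := by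
  have hp := (hα.p_pos m (Nat.lt_succ_self m)).le
  have hv := hα.visits_pos.le
  have hupd : ∀ (u : ℕ → ℝ) (x : ℝ), (∀ k ≤ m + 1, 0 ≤ u k) → 0 ≤ x →
      ∀ k ≤ m, 0 ≤ Function.update u m (p m * x + u m) k := by
    intro u x hu hx k hk
    rcases eq_or_ne k m with rfl | hne
    · rw [Function.update_self]
      exact add_nonneg (mul_nonneg hp hx) (hu _ (Nat.le_succ _))
    · rw [Function.update_of_ne hne]
      exact hu k (by omega)
  -- The mass condition is itself an instance of `Bounded`, with all rewards and values equal to 1,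
  -- so `Bounded.pop` transports it. The bound on the right makes the root condition an equality.
  have hb : α.Bounded ⟨1, 1, 1⟩ 1 (α.reward ⟨1, 1, 1⟩ 0 + p 0) (m + 1) p (fun _ => 1)
      (fun _ => 0) := by
    constructor
    · simp
    · intro k hk
      have := hα.mass k hk
      simpa [reward] using this
  have hb' := hb.pop hα one_pos le_rfl
  refine ⟨?_, ?_, ?_, ?_, ?_, ?_⟩
  · exact hupd _ _ hα.goal_nonneg (mul_nonneg hv (hα.goal_nonneg _ le_rfl))
  · exact hupd _ _ hα.fail_nonneg (mul_nonneg hv (hα.fail_nonneg _ le_rfl))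
  · refine hupd _ _ hα.noter_nonneg ?_
    split_ifs
    · exact zero_le_one
    · exact mul_nonneg hv (hα.noter_nonneg _ le_rfl)
  · intro i k hik hk
    have h1 := hα.loop_nonneg i k hik (by omega)
    rcases eq_or_ne (k + 1) m with rfl | hne
    · rw [pop_loop_succ hik]
      exact add_nonneg (mul_nonneg hp (mul_nonneg hv
        (hα.loop_nonneg i (k + 1) (by omega) (Nat.lt_succ_self _)))) h1
    · rwa [pop_loop_of_ne hne]
  · exact fun k hk => hα.p_pos k (by omega)
  · intro k hk
    simpa [reward] using hb'.level k hk

/-- When all runs through the last element of the history are recorded, the mass that they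
contribute is the probability of the move to this element. -/
theorem Valid.pop_mass (hα : α.Valid (m + 1) p)
    (hm : α.goal (m + 1) + α.fail (m + 1) + α.noter (m + 1)
      + ∑ i ∈ Finset.range (m + 1), α.loop i m = 1) :
    (α.pop p m).goal m + (α.pop p m).fail m + (α.pop p m).noter m
      + p m * ∑ i ∈ Finset.range m, α.visits m * α.loop i m
      = α.goal m + α.fail m + α.noter m + p m := by
  rw [Finset.sum_range_succ] at hm
  by_cases hs : α.loop m m + α.noter (m + 1) = 1
  · obtain ⟨hg, hf, hl⟩ := hα.special hs
    have hsum : ∑ i ∈ Finset.range m, α.visits m * α.loop i m = 0 :=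
      Finset.sum_eq_zero fun i hi => by rw [hl i (Finset.mem_range.1 hi)]; ring
    simp only [Alpha.pop, Function.update_self, if_pos hs, hg, hf, hsum]
    ring
  · have hpos : 0 < 1 - α.loop m m := sub_pos.2 (hα.loop_lt_one hs)
    have hv : α.visits m = (1 - α.loop m m)⁻¹ := by simp [visits, hs]
    have key : α.visits m * (α.goal (m + 1) + α.fail (m + 1) + α.noter (m + 1)
        + ∑ i ∈ Finset.range m, α.loop i m) = 1 := by
      rw [hv, inv_mul_eq_one₀ hpos.ne']
      linarith
    simp only [Alpha.pop, Function.update_self, if_neg hs, ← Finset.mul_sum]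
    linear_combination p m * key

end Alpha

/-! ### The values `λ` by repeated elimination -/

theorem lambdaLoop_eq_sum (p : ℕ → ℝ) (α : Alpha) (L : ℕ → ℝ) {n k : ℕ} (hk : k < n) :
    lambdaLoop p α L n k =
      ∑ m ∈ Finset.Ico k n, (∏ j ∈ Finset.Ioc k m, p j * (1 - L j)⁻¹) * α.loop k m := by
  rw [lambdaLoop, ← Finset.Ioo_insert_left hk, Finset.sum_insert Finset.left_notMem_Ioo]
  simp

/-- In the sum over the points at which the history is left, the terms for `m` and `m - 1` share the
path up to `m - 1`; `pop` merges these two columns. The factor of `h⁽ᵐ⁾` is compared only after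
multiplication by `α.loop k m`, since a reset may change the factor itself. -/
theorem lambdaLoop_pop {p : ℕ → ℝ} {α : Alpha} {L L' : ℕ → ℝ} {m k : ℕ} (hk : k < m)
    (hL : ∀ j < m, L j = L' j) (hm : (1 - L m)⁻¹ * α.loop k m = α.visits m * α.loop k m) :
    lambdaLoop p α L (m + 1) k = lambdaLoop p (α.pop p m) L' m k := by
  obtain ⟨m, rfl⟩ : ∃ m', m = m' + 1 := ⟨m - 1, by omega⟩
  have hprod : ∀ j < m + 1, ∏ i ∈ Finset.Ioc k j, p i * (1 - L i)⁻¹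
      = ∏ i ∈ Finset.Ioc k j, p i * (1 - L' i)⁻¹ := fun j hj =>
    Finset.prod_congr rfl fun i hi => by rw [hL i (by have := Finset.mem_Ioc.1 hi; omega)]
  rw [lambdaLoop_eq_sum _ _ _ (by omega), lambdaLoop_eq_sum _ _ _ hk,
    Finset.sum_Ico_succ_top (by omega), Finset.sum_Ico_succ_top (by omega),
    Finset.sum_Ico_succ_top (by omega), Finset.prod_Ioc_succ_top (by omega), add_assoc]
  congr 1
  · refine Finset.sum_congr rfl fun j hj => ?_
    have hj := Finset.mem_Ico.1 hj
    rw [hprod j (by omega), Alpha.pop_loop_of_ne (by omega)]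
  · rw [hprod m (by omega), Alpha.pop_loop_succ (by omega)]
    linear_combination (∏ i ∈ Finset.Ioc k m, p i * (1 - L' i)⁻¹) * p (m + 1) * hm

/-- The condition that no run from `h⁽ⁿ⁻ᵈ⁻¹⁾` terminates, tested in round `d + 1`. -/
def NoTermination (p : ℕ → ℝ) (α : Alpha) (n d : ℕ) : Prop :=
  lambdaLoop p α (lambdaAfter p α n d).loop n (n - (d + 1)) + (lambdaAfter p α n d).noter = 1

theorem lambdaAfter_succ_of_noTermination {p : ℕ → ℝ} {α : Alpha} {n d : ℕ}
    (h : NoTermination p α n d) :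
    lambdaAfter p α n (d + 1) =
      { goal := p (n - (d + 1)) * (lambdaAfter p α n d).goal + α.goal (n - (d + 1))
        fail := p (n - (d + 1)) * (lambdaAfter p α n d).fail + α.fail (n - (d + 1))
        noter := p (n - (d + 1)) + α.noter (n - (d + 1))
        loop := fun _ => 0 } := by
  rw [lambdaAfter]
  exact if_pos h

theorem lambdaAfter_succ_of_not_noTermination {p : ℕ → ℝ} {α : Alpha} {n d : ℕ}
    (h : ¬NoTermination p α n d) :
    lambdaAfter p α n (d + 1) =
      let l := lambdaLoop p α (lambdaAfter p α n d).loop n (n - (d + 1))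
      { goal := p (n - (d + 1)) * (lambdaAfter p α n d).goal / (1 - l) + α.goal (n - (d + 1))
        fail := p (n - (d + 1)) * (lambdaAfter p α n d).fail / (1 - l) + α.fail (n - (d + 1))
        noter := p (n - (d + 1)) * (lambdaAfter p α n d).noter / (1 - l) + α.noter (n - (d + 1))
        loop := Function.update (lambdaAfter p α n d).loop (n - (d + 1)) l } := by
  rw [lambdaAfter]
  exact if_neg h

/-- The relation between the values for a history and for the history without its last element
`h⁽ᵐ⁾`, after round `d + 1` and round `d`. -/
structure PopRel (α : Alpha) (m d : ℕ) (A B : Lambda) : Prop where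
  goal : A.goal = B.goal
  fail : A.fail = B.fail
  noter : A.noter = B.noter
  loop : ∀ j < m, A.loop j = B.loop j
  last : ∀ i < m - d, (1 - A.loop m)⁻¹ * α.loop i m = α.visits m * α.loop i m

theorem lambdaLoop_last (p : ℕ → ℝ) (α : Alpha) (L : ℕ → ℝ) (m : ℕ) :
    lambdaLoop p α L (m + 1) m = α.loop m m := by
  simp [lambdaLoop_eq_sum p α L (Nat.lt_succ_self m)]

theorem noTermination_zero {p : ℕ → ℝ} {α : Alpha} {m : ℕ} :
    NoTermination p α (m + 1) 0 ↔ α.loop m m + α.noter (m + 1) = 1 := by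
  simp [NoTermination, lambdaAfter, lambdaLoop_last]

/-- The first round of the λ computation and `pop` perform the same elimination of `h⁽ᵐ⁾`. -/
theorem popRel_zero (p : ℕ → ℝ) (α : Alpha) (m : ℕ) :
    PopRel α m 0 (lambdaAfter p α (m + 1) 1) (lambdaAfter p (α.pop p m) m 0) := by
  by_cases hs : NoTermination p α (m + 1) 0
  · have hs' := noTermination_zero.1 hs
    rw [lambdaAfter_succ_of_noTermination hs]
    constructor <;> simp [lambdaAfter, Alpha.pop, Alpha.visits, hs']
  · have hs' := mt noTermination_zero.2 hs
    rw [lambdaAfter_succ_of_not_noTermination hs]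
    constructor <;> simp [lambdaAfter, Alpha.pop, Alpha.visits, hs', lambdaLoop_last]
    · ring
    · ring
    · ring
    · intro j hj
      rw [Function.update_of_ne hj.ne]

theorem PopRel.noTermination_iff {p : ℕ → ℝ} {α : Alpha} {m d : ℕ} (hd : d < m)
    (h : PopRel α m d (lambdaAfter p α (m + 1) (d + 1)) (lambdaAfter p (α.pop p m) m d)) :
    lambdaLoop p α (lambdaAfter p α (m + 1) (d + 1)).loop (m + 1) (m + 1 - (d + 1 + 1))
      = lambdaLoop p (α.pop p m) (lambdaAfter p (α.pop p m) m d).loop m (m - (d + 1)) ∧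
    (NoTermination p α (m + 1) (d + 1) ↔ NoTermination p (α.pop p m) m d) := by
  have hk : m + 1 - (d + 1 + 1) = m - (d + 1) := by omega
  have hl := lambdaLoop_pop (p := p) (α := α) (k := m - (d + 1)) (by omega) h.loop
    (h.last _ (by omega))
  rw [hk]
  refine ⟨hl, ?_⟩
  unfold NoTermination
  rw [hk, hl, h.noter]

/-- The delicate case is a reset: it also sets the loop value of `h⁽ᵐ⁾` to `0`, whereas `visits m`
keeps its old value. By `hz` the discrepancy is only ever multiplied by zero. -/
theorem PopRel.succ {p : ℕ → ℝ} {α : Alpha} {m d : ℕ} (hd : d < m)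
    (h : PopRel α m d (lambdaAfter p α (m + 1) (d + 1)) (lambdaAfter p (α.pop p m) m d))
    (hz : NoTermination p (α.pop p m) m d → ∀ i < m - (d + 1), α.loop i m = 0) :
    PopRel α m (d + 1) (lambdaAfter p α (m + 1) (d + 1 + 1))
      (lambdaAfter p (α.pop p m) m (d + 1)) := by
  have hk : m + 1 - (d + 1 + 1) = m - (d + 1) := by omega
  have hkm : m - (d + 1) < m := by omega
  obtain ⟨hl, hiff⟩ := h.noTermination_iff hd
  by_cases hs : NoTermination p (α.pop p m) m d
  · rw [lambdaAfter_succ_of_noTermination hs, lambdaAfter_succ_of_noTermination (hiff.2 hs), hk]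
    constructor
    · simp [h.goal, Alpha.pop_goal_of_lt hkm]
    · simp [h.fail, Alpha.pop_fail_of_lt hkm]
    · simp [Alpha.pop_noter_of_lt hkm]
    · simp
    · intro i hi
      simp [hz hs i hi]
  · rw [lambdaAfter_succ_of_not_noTermination hs,
      lambdaAfter_succ_of_not_noTermination (mt hiff.1 hs), hl, hk]
    constructor
    · simp [h.goal, Alpha.pop_goal_of_lt hkm]
    · simp [h.fail, Alpha.pop_fail_of_lt hkm]
    · simp [h.noter, Alpha.pop_noter_of_lt hkm]
    · intro j hj
      dsimp only
      by_cases hjk : j = m - (d + 1)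
      · rw [hjk, Function.update_self, Function.update_self]
      · rw [Function.update_of_ne hjk, Function.update_of_ne hjk, h.loop j hj]
    · intro i hi
      dsimp only
      rw [Function.update_of_ne hkm.ne']
      exact h.last i (by omega)

/-- If no run from `h⁽ᵏ⁾` terminates, none of these returns to an earlier element of the history. -/
theorem Alpha.Valid.loop_eq_zero {p : ℕ → ℝ} {n : ℕ} : ∀ {α : Alpha}, α.Valid n p →
    ∀ d < n, NoTermination p α n d →
      ∀ i j, i < n - (d + 1) → n - (d + 1) ≤ j → j < n → α.loop i j = 0 := by
  induction n with
  | zero => exact fun _ d hd => absurd hd (Nat.not_lt_zero d)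
  | succ m ih =>
    intro α hα
    -- Each rolled-up loop entry is a sum of nonnegative terms, the last column with a positive
    -- factor. If it vanishes for the shorter history, both original columns vanish.
    have hz : ∀ d < m, NoTermination p (α.pop p m) m d →
        ∀ i j, i < m - (d + 1) → m - (d + 1) ≤ j → j ≤ m → α.loop i j = 0 := by
      intro d hd hs i j hi hj hjm
      have hzero := ih hα.pop d hd hs
      have hp := hα.p_pos m (Nat.lt_succ_self m)
      obtain ⟨m, rfl⟩ : ∃ m', m = m' + 1 := ⟨m - 1, by omega⟩
      have h1 := hzero i m hi (by omega) (Nat.lt_succ_self m)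
      rw [pop_loop_succ (by omega)] at h1
      have h2 := hα.loop_nonneg i (m + 1) (by omega) (by omega)
      have h3 := hα.loop_nonneg i m (by omega) (by omega)
      have h4 : 0 < p (m + 1) * α.visits (m + 1) := mul_pos hp hα.visits_pos
      rcases Nat.lt_or_ge j m with hjm' | hjm'
      · have := hzero i j hi hj (by omega)
        rwa [pop_loop_of_ne (by omega)] at this
      · rw [← mul_assoc] at h1
        have h5 := mul_nonneg h4.le h2
        obtain rfl | rfl : j = m ∨ j = m + 1 := by omega
        · linarith
        · have : p (m + 1) * α.visits (m + 1) * α.loop i (m + 1) = 0 := by linarith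
          exact (mul_eq_zero.1 this).resolve_left h4.ne'
    -- The relation must be built here, since the claim itself is needed to pass through resets; the
    -- induction hypothesis supplies it for the popped bookkeeping.
    have hrel : ∀ d ≤ m,
        PopRel α m d (lambdaAfter p α (m + 1) (d + 1)) (lambdaAfter p (α.pop p m) m d) := by
      intro d
      induction d with
      | zero => exact fun _ => popRel_zero p α m
      | succ d ihd =>
        exact fun hd => (ihd (by omega)).succ (by omega)
          fun hs i hi => hz d (by omega) hs i m hi (by omega) le_rfl
    rintro (_ | d) hd hs i j hi hj hjm
    · obtain rfl : j = m := by omega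
      exact (hα.special (noTermination_zero.1 hs)).2.2 i (by omega)
    · have hd : d < m := by omega
      exact hz d hd (((hrel d hd.le).noTermination_iff hd).2.1 hs) i j (by omega) (by omega)
        (by omega)

theorem Alpha.Valid.popRel {p : ℕ → ℝ} {α : Alpha} {m : ℕ} (hα : α.Valid (m + 1) p) :
    ∀ d ≤ m, PopRel α m d (lambdaAfter p α (m + 1) (d + 1)) (lambdaAfter p (α.pop p m) m d) := by
  intro d
  induction d with
  | zero => exact fun _ => popRel_zero p α m
  | succ d ih =>
    intro hd
    have h := ih (by omega)
    exact h.succ (by omega) fun hs i hi => hα.loop_eq_zero (d + 1) (by omega)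
      ((h.noTermination_iff (by omega)).2.2 hs) i m (by omega) (by omega) (by omega)

/-- The value of the outcomes that are recorded is at most the value of the initial state. -/
theorem Alpha.Valid.lambda_le {p : ℕ → ℝ} {w : Reward} {ε b : ℝ} {F ρ : ℕ → ℝ} {n : ℕ}
    (hε : 0 < ε) (hρ : ∀ k ≤ n, 0 ≤ ρ k) : ∀ {α : Alpha}, α.Valid n p →
    α.Bounded w ε b n p F ρ →
    w.goal * (lambdaAfter p α n n).goal + w.fail * (lambdaAfter p α n n).fail
      + w.noter * (lambdaAfter p α n n).noter ≤ b := by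
  induction n with
  | zero =>
    intro α _ hb
    have := hb.root
    have := hρ 0 le_rfl
    simp [reward, lambdaAfter] at *
    linarith
  | succ m ih =>
    intro α hα hb
    -- Popping leaves the final λ values unchanged, so the induction runs down to the empty history.
    have h := hα.popRel m le_rfl
    rw [h.goal, h.fail, h.noter]
    exact ih (fun k hk => hρ k (by omega)) hα.pop (hb.pop hα hε (hρ _ le_rfl))

end Pandor

namespace Pandor

open scoped ENNReal

variable {S A O : Type*} {N : ℕ}

/-! ### The likelihood of goal termination by the length of the history -/

open Classical in
/-- The probability with which the system, started in the given combined state, terminates in a goal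
state after exactly `t` steps. -/
noncomputable def hit [Fintype S] (P : PlanningProblem S A O) (C : Ctrl A O N) :
    ℕ → Fin N × S → ℝ≥0∞
  | 0, c =>
    match C c.1 (P.env.Ω c.2) with
    | some (.halt, _) => if c.2 ∈ P.goals then 1 else 0
    | _ => 0
  | t + 1, c =>
    match C c.1 (P.env.Ω c.2) with
    | some (.act a, q') => ∑ s', P.env.Δ c.2 a s' * hit P C t (q', s')
    | _ => 0

/-- The probability of the move from one combined state to another. -/
noncomputable def kernel (P : PlanningProblem S A O) (C : Ctrl A O N) (c c' : Fin N × S) : ℝ≥0∞ :=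
  match C c.1 (P.env.Ω c.2) with
  | some (.act a, q') => if c'.1 = q' then P.env.Δ c.2 a c'.2 else 0
  | _ => 0

/-- The likelihood of a list of combined states if it is a run that terminates in a goal state, and
`0` otherwise. -/
noncomputable def goalWeight [Fintype S] (P : PlanningProblem S A O) (C : Ctrl A O N) :
    List (Fin N × S) → ℝ≥0∞
  | [] => 0
  | [c] => hit P C 0 c
  | c :: c' :: l => kernel P C c c' * goalWeight P C (c' :: l)

section

variable (P : PlanningProblem S A O) (C : Ctrl A O N)

section

variable [Fintype S]

theorem hit_succ (t : ℕ) (c : Fin N × S) :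
    hit P C (t + 1) c = ∑ c', kernel P C c c' * hit P C t c' := by
  rw [hit, Fintype.sum_prod_type_right]
  simp only [kernel]
  rcases C c.1 (P.env.Ω c.2) with _ | ⟨_ | _, q'⟩ <;> simp

/-- A nonempty list is a head and a tail; summing over the tails first turns the sum over runs into
the one-step recursion of `hit`. -/
theorem tsum_goalWeight_length (t : ℕ) (c : Fin N × S) :
    ∑' l : List (Fin N × S), (if l.length = t then goalWeight P C (c :: l) else 0)
      = hit P C t c := by
  induction t generalizing c with
  | zero =>
    rw [tsum_eq_single []]
    · simp [goalWeight]
    · intro l hl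
      simp [hl]
  | succ t ih =>
    have hinj : Function.Injective (fun x : (Fin N × S) × List (Fin N × S) => x.1 :: x.2) := by
      rintro ⟨a, l⟩ ⟨a', l'⟩ h
      simpa using h
    rw [← hinj.tsum_eq, ENNReal.tsum_prod', tsum_fintype, hit_succ]
    · refine Finset.sum_congr rfl fun c' _ => ?_
      rw [← ih c', ← ENNReal.tsum_mul_left]
      refine tsum_congr fun l => ?_
      simp [goalWeight]
    · rintro (_ | ⟨a, l⟩) hl
      · simp at hl
      · exact ⟨(a, l), rfl⟩

theorem tsum_goalWeight (c : Fin N × S) :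
    ∑' l : List (Fin N × S), goalWeight P C (c :: l) = ∑' t, hit P C t c := by
  simp_rw [← tsum_goalWeight_length P C]
  rw [ENNReal.tsum_comm]
  refine tsum_congr fun l => ?_
  rw [tsum_eq_single l.length]
  · simp
  · intro t ht
    simp [ht.symm]

end

variable {P C}

theorem step_toFSC_iff {hN : 0 < N} {c c' : Fin N × S} :
    (C.toFSC hN).Step P.env c c' ↔
      ∃ a, C c.1 (P.env.Ω c.2) = some (.act a, c'.1) ∧ 0 < P.env.Δ c.2 a c'.2 := by
  simp only [FSC.Step, Ctrl.toFSC]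
  rcases C c.1 (P.env.Ω c.2) with _ | ⟨_ | _, q'⟩ <;> simp

theorem kernel_eq_zero {hN : 0 < N} {c c' : Fin N × S} (h : ¬(C.toFSC hN).Step P.env c c') :
    kernel P C c c' = 0 := by
  rw [step_toFSC_iff] at h
  rw [kernel]
  rcases hC : C c.1 (P.env.Ω c.2) with _ | ⟨a | _, q'⟩ <;> simp only
  rw [hC] at h
  split_ifs with hq
  · subst hq
    simpa using h
  · rfl

theorem kernel_eq_responseProb {hN : 0 < N} {c c' : Fin N × S}
    (h : (C.toFSC hN).Step P.env c c') :
    kernel P C c c' = (C.toFSC hN).responseProb P.env c c'.2 := by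
  obtain ⟨a, h, -⟩ := step_toFSC_iff.1 h
  simp [kernel, FSC.responseProb, Ctrl.toFSC, h]

end

-- The sum over goal histories as a sum over numbers of steps

/-- The list is a run that terminates in a goal state. -/
def IsGoalRun (P : PlanningProblem S A O) (C : FSC A O) (h : List (C.Combined S)) : Prop :=
  h.IsChain (C.Step P.env) ∧
    ∃ c, h.getLast? = some c ∧ C.γ c.1 (P.env.Ω c.2) = some .halt ∧ c.2 ∈ P.goals

section

variable {P : PlanningProblem S A O} {C : FSC A O}

theorem isGoalRun_cons_cons {c c' : C.Combined S} {l : List (C.Combined S)} :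
    IsGoalRun P C (c :: c' :: l) ↔ C.Step P.env c c' ∧ IsGoalRun P C (c' :: l) := by
  simp [IsGoalRun, List.getLast?_cons_cons, and_assoc]

theorem isGoalRun_singleton {c : C.Combined S} :
    IsGoalRun P C [c] ↔ C.γ c.1 (P.env.Ω c.2) = some .halt ∧ c.2 ∈ P.goals := by
  simp [IsGoalRun]

/-- All goal histories have the same first element, so they are indexed by their tails. -/
theorem LGT_eq_tsum_indicator (P : PlanningProblem S A O) (C : FSC A O) :
    C.LGT P = ∑' l : List (C.Combined S), {l | IsGoalRun P C ((C.q₀, P.s₀) :: l)}.indicator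
      (fun l => C.likelihood P.env ((C.q₀, P.s₀) :: l)) l := by
  rw [FSC.LGT]
  have hinj : Function.Injective fun l : List (C.Combined S) => (C.q₀, P.s₀) :: l :=
    List.cons_injective
  have hmem : ∀ l : List (C.Combined S), C.IsGoalHistory P ((C.q₀, P.s₀) :: l) ↔
      IsGoalRun P C ((C.q₀, P.s₀) :: l) := by
    intro l
    simp [FSC.IsGoalHistory, FSC.IsHistory, IsGoalRun]
  refine (tsum_subtype {h | C.IsGoalHistory P h} (C.likelihood P.env)).trans ?_
  rw [← hinj.tsum_eq]
  · refine tsum_congr fun l => ?_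
    by_cases hl : IsGoalRun P C ((C.q₀, P.s₀) :: l)
    · exact (Set.indicator_of_mem (s := {h | C.IsGoalHistory P h}) ((hmem l).2 hl) _).trans
        (Set.indicator_of_mem (s := {l | IsGoalRun P C ((C.q₀, P.s₀) :: l)}) hl
          fun l => C.likelihood P.env ((C.q₀, P.s₀) :: l)).symm
    · exact (Set.indicator_of_notMem (s := {h | C.IsGoalHistory P h}) (mt (hmem l).1 hl) _).trans
        (Set.indicator_of_notMem (s := {l | IsGoalRun P C ((C.q₀, P.s₀) :: l)}) hl
          fun l => C.likelihood P.env ((C.q₀, P.s₀) :: l)).symm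
  · intro l hl
    obtain ⟨⟨hhead, -⟩, -⟩ := Set.mem_of_indicator_ne_zero hl
    rcases l with _ | ⟨c, l⟩
    · simp at hhead
    · rw [List.head?_cons, Option.some.injEq] at hhead
      exact ⟨l, by rw [hhead]⟩

end

section

variable (P : PlanningProblem S A O) (C : Ctrl A O N) (hN : 0 < N)

/-- `IsGoalRun` for the controller given by a set of transitions. -/
def Ctrl.IsGoalRun (h : List (Fin N × S)) : Prop := Pandor.IsGoalRun P (C.toFSC hN) h

/-- The likelihood of a history for the controller given by a set of transitions. -/
noncomputable def Ctrl.likelihood (h : List (Fin N × S)) : ℝ≥0∞ :=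
  (C.toFSC hN).likelihood P.env h

variable [Fintype S]

theorem goalWeight_eq (c : Fin N × S) (l : List (Fin N × S)) :
    (C.IsGoalRun P hN (c :: l) → goalWeight P C (c :: l) = C.likelihood P hN (c :: l)) ∧
    (¬C.IsGoalRun P hN (c :: l) → goalWeight P C (c :: l) = 0) := by
  induction l generalizing c with
  | nil =>
    have hiff : C.IsGoalRun P hN [c] ↔
        (C c.1 (P.env.Ω c.2)).map Prod.fst = some .halt ∧ c.2 ∈ P.goals :=
      isGoalRun_singleton (C := C.toFSC hN)
    have hlik : C.likelihood P hN [c] = 1 := rfl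
    rw [hiff, hlik, goalWeight, hit]
    rcases C c.1 (P.env.Ω c.2) with _ | ⟨_ | _, q'⟩ <;> simp
  | cons c' l ih =>
    have hiff : C.IsGoalRun P hN (c :: c' :: l) ↔
        (C.toFSC hN).Step P.env c c' ∧ C.IsGoalRun P hN (c' :: l) :=
      isGoalRun_cons_cons (C := C.toFSC hN)
    have hlik : C.likelihood P hN (c :: c' :: l) =
        (C.toFSC hN).responseProb P.env c c'.2 * C.likelihood P hN (c' :: l) := rfl
    rw [hiff, hlik, goalWeight]
    constructor
    · rintro ⟨hs, hr⟩
      rw [(ih c').1 hr, kernel_eq_responseProb hs]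
    · intro h
      by_cases hs : (C.toFSC hN).Step P.env c c'
      · rw [(ih c').2 fun hr => h ⟨hs, hr⟩, mul_zero]
      · rw [kernel_eq_zero hs, zero_mul]

theorem LGT_toFSC : (C.toFSC hN).LGT P = ∑' t, hit P C t (⟨0, hN⟩, P.s₀) := by
  have h : (C.toFSC hN).LGT P = ∑' l : List (Fin N × S),
      {l | C.IsGoalRun P hN ((⟨0, hN⟩, P.s₀) :: l)}.indicator
        (fun l => C.likelihood P hN ((⟨0, hN⟩, P.s₀) :: l)) l :=
    LGT_eq_tsum_indicator P (C.toFSC hN)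
  rw [h, ← tsum_goalWeight]
  refine tsum_congr fun l => ?_
  by_cases hl : C.IsGoalRun P hN ((⟨0, hN⟩, P.s₀) :: l)
  · rw [Set.indicator_of_mem (by exact hl), (goalWeight_eq P C hN _ l).1 hl]
  · rw [Set.indicator_of_notMem (by exact hl), (goalWeight_eq P C hN _ l).2 hl]

end

-- Discounted likelihood of goal termination

section

variable {P : PlanningProblem S A O} {C : Ctrl A O N} [Fintype S]

theorem sum_transition (s : S) (a : A) : ∑ s', P.env.Δ s a s' = 1 := by
  have h := PMF.tsum_coe (P.env.Δ s a)
  rwa [tsum_fintype] at h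

theorem sum_transition_toReal (s : S) (a : A) : ∑ s', (P.env.Δ s a s').toReal = 1 := by
  rw [← ENNReal.toReal_sum fun s' _ => PMF.apply_ne_top _ s', sum_transition, ENNReal.toReal_one]

variable (P C)

/-- Conditioning on the first step: the controller either stops, which contributes at step 0 only,
or moves to an average of states with one step fewer to go. -/
theorem sum_hit_le_one (T : ℕ) (c : Fin N × S) : ∑ t ∈ Finset.range T, hit P C t c ≤ 1 := by
  induction T generalizing c with
  | zero => simp
  | succ T ih =>
    rw [Finset.sum_range_succ']
    simp only [hit]
    rcases C c.1 (P.env.Ω c.2) with _ | ⟨a | _, q'⟩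
    · simp
    · simp only [add_zero]
      rw [Finset.sum_comm]
      calc _ = ∑ s', P.env.Δ c.2 a s' * ∑ t ∈ Finset.range T, hit P C t (q', s') :=
            Finset.sum_congr rfl fun s' _ => (Finset.mul_sum _ _ _).symm
        _ ≤ ∑ s', P.env.Δ c.2 a s' * 1 :=
            Finset.sum_le_sum fun s' _ => by gcongr; exact ih _
        _ = 1 := by simp [sum_transition]
    · simp only [Finset.sum_const_zero, zero_add]
      split_ifs <;> simp

theorem tsum_hit_le_one (c : Fin N × S) : ∑' t, hit P C t c ≤ 1 :=
  ENNReal.tsum_le_of_sum_range_le fun T => sum_hit_le_one P C T c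

theorem hit_ne_top (t : ℕ) (c : Fin N × S) : hit P C t c ≠ ∞ :=
  ne_top_of_le_ne_top ENNReal.one_ne_top ((ENNReal.le_tsum t).trans (tsum_hit_le_one P C c))

/-- The likelihood of goal termination from the given combined state, where each step is discounted
by the factor `β`. -/
noncomputable def discounted (β : ℝ) (c : Fin N × S) : ℝ := ∑' t, β ^ t * (hit P C t c).toReal

theorem summable_hit (c : Fin N × S) : Summable fun t => (hit P C t c).toReal :=
  ENNReal.summable_toReal (ne_top_of_le_ne_top ENNReal.one_ne_top (tsum_hit_le_one P C c))

theorem discounted_one (c : Fin N × S) : discounted P C 1 c = (∑' t, hit P C t c).toReal := by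
  simp [discounted, ENNReal.tsum_toReal_eq fun t => hit_ne_top P C t c]

theorem discounted_one_le_one (c : Fin N × S) : discounted P C 1 c ≤ 1 := by
  rw [discounted_one, ← ENNReal.toReal_one]
  exact ENNReal.toReal_mono ENNReal.one_ne_top (tsum_hit_le_one P C c)

theorem LGT_toFSC_eq_discounted (hN : 0 < N) :
    (C.toFSC hN).LGT P = ENNReal.ofReal (discounted P C 1 (⟨0, hN⟩, P.s₀)) := by
  rw [discounted_one, ENNReal.ofReal_toReal
    (ne_top_of_le_ne_top ENNReal.one_ne_top (tsum_hit_le_one P C _)), LGT_toFSC]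

variable {β : ℝ}

theorem summable_discounted (h0 : 0 ≤ β) (h1 : β ≤ 1) (c : Fin N × S) :
    Summable fun t => β ^ t * (hit P C t c).toReal :=
  (summable_hit P C c).of_nonneg_of_le
    (fun _ => mul_nonneg (pow_nonneg h0 _) ENNReal.toReal_nonneg)
    fun _ => mul_le_of_le_one_left ENNReal.toReal_nonneg (pow_le_one₀ h0 h1)

theorem discounted_nonneg (h0 : 0 ≤ β) (c : Fin N × S) : 0 ≤ discounted P C β c :=
  tsum_nonneg fun _ => mul_nonneg (pow_nonneg h0 _) ENNReal.toReal_nonneg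

theorem discounted_le_one (h0 : 0 ≤ β) (h1 : β ≤ 1) (c : Fin N × S) : discounted P C β c ≤ 1 := by
  refine le_trans ?_ (discounted_one_le_one P C c)
  refine (summable_discounted P C h0 h1 c).tsum_le_tsum (fun t => ?_)
    (summable_discounted P C zero_le_one le_rfl c)
  gcongr

theorem discounted_eq (h0 : 0 ≤ β) (h1 : β ≤ 1) (c : Fin N × S) :
    discounted P C β c =
      (hit P C 0 c).toReal + ∑' t, β ^ (t + 1) * (hit P C (t + 1) c).toReal := by
  rw [discounted, (summable_discounted P C h0 h1 c).tsum_eq_zero_add]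
  simp

variable {P C}

/-- The Bellman equation; summability permits exchanging the series with the finite sum over next
states. -/
theorem discounted_of_act (h0 : 0 ≤ β) (h1 : β ≤ 1) {q q' : Fin N} {s : S} {a : A}
    (h : C q (P.env.Ω s) = some (.act a, q')) :
    discounted P C β (q, s) = β * ∑ s', (P.env.Δ s a s').toReal * discounted P C β (q', s') := by
  rw [discounted_eq P C h0 h1]
  have hz : hit P C 0 (q, s) = 0 := by simp [hit, h]
  have hs : ∀ t, β ^ (t + 1) * (hit P C (t + 1) (q, s)).toReal
      = ∑ s', β * ((P.env.Δ s a s').toReal * (β ^ t * (hit P C t (q', s')).toReal)) := by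
    intro t
    have : hit P C (t + 1) (q, s) = ∑ s', P.env.Δ s a s' * hit P C t (q', s') := by
      simp [hit, h]
    rw [this, ENNReal.toReal_sum fun s' _ =>
      ENNReal.mul_ne_top (PMF.apply_ne_top _ s') (hit_ne_top P C t _), Finset.mul_sum]
    refine Finset.sum_congr rfl fun s' _ => ?_
    rw [ENNReal.toReal_mul]
    ring
  simp_rw [hs]
  rw [Summable.tsum_finsetSum fun s' _ =>
    ((summable_discounted P C h0 h1 (q', s')).mul_left _).mul_left _, hz, Finset.mul_sum]
  simp [discounted, tsum_mul_left]

theorem discounted_of_halt (h0 : 0 ≤ β) (h1 : β ≤ 1) {q q' : Fin N} {s : S}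
    (h : C q (P.env.Ω s) = some (.halt, q')) [Decidable (s ∈ P.goals)] :
    discounted P C β (q, s) = if s ∈ P.goals then 1 else 0 := by
  rw [discounted_eq P C h0 h1]
  split_ifs with hs <;> simp [hit, h, hs]

/-- Each partial sum is a polynomial in `β`, hence continuous, and is bounded by `u` for `0 < β <
1`; let `β → 1` from the left before letting the number of terms grow. -/
theorem discounted_one_le_of_forall {c : Fin N × S} {u : ℝ}
    (h : ∀ β, 0 < β → β < 1 → discounted P C β c ≤ u) : discounted P C 1 c ≤ u := by
  simp only [discounted, one_pow, one_mul]
  refine Real.tsum_le_of_sum_range_le (fun _ => ENNReal.toReal_nonneg) fun T => ?_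
  have hcont : Continuous fun β : ℝ => ∑ t ∈ Finset.range T, β ^ t * (hit P C t c).toReal := by
    fun_prop
  have hlim := (hcont.tendsto 1).mono_left (nhdsWithin_le_nhds (s := Set.Iio 1))
  simp only [one_pow, one_mul] at hlim
  refine le_of_tendsto hlim ?_
  filter_upwards [Ioo_mem_nhdsLT (zero_lt_one' ℝ)] with β hβ
  refine le_trans ?_ (h β hβ.1 hβ.2)
  exact (summable_discounted P C hβ.1.le hβ.2.le c).sum_le_tsum _
    fun _ _ => mul_nonneg (pow_nonneg hβ.1.le _) ENNReal.toReal_nonneg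

end

/-! ### Controllers as sets of transitions -/

/-- The set of transitions of a controller with at most `N` states; the controller stops where it
has none. -/
def ofFSC (C : FSC A O) (hN : 0 < N) (hC : C.numStates ≤ N) : Ctrl A O N := fun q o =>
  if h : q.1 < C.numStates then
    match C.γ ⟨q.1, h⟩ o, C.δ ⟨q.1, h⟩ o with
    | some (.act a), some q' => some (.act a, Fin.castLE hC q')
    | _, _ => some (.halt, ⟨0, hN⟩)
  else some (.halt, ⟨0, hN⟩)

section

variable (C : FSC A O) (hN : 0 < N) (hC : C.numStates ≤ N)

theorem ofFSC_ne_none (q : Fin N) (o : O) : ofFSC C hN hC q o ≠ none := by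
  unfold ofFSC
  split_ifs
  · split <;> simp
  · simp

theorem ofFSC_castLE_act {q q' : Fin C.numStates} {o : O} {a : A} (hγ : C.γ q o = some (.act a))
    (hδ : C.δ q o = some q') :
    ofFSC C hN hC (Fin.castLE hC q) o = some (.act a, Fin.castLE hC q') := by
  simp [ofFSC, hγ, hδ]

theorem ofFSC_castLE_halt {q : Fin C.numStates} {o : O} (hγ : C.γ q o = some .halt) :
    ofFSC C hN hC (Fin.castLE hC q) o = some (.halt, ⟨0, hN⟩) := by
  simp [ofFSC, hγ]

/-- Goal histories use only defined transitions and end in an explicit stop, all of which are kept.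
They therefore embed with the same likelihood, and the added stops can only create further goal
histories. -/
theorem LGT_le_LGT_ofFSC (P : PlanningProblem S A O) :
    C.LGT P ≤ ((ofFSC C hN hC).toFSC hN).LGT P := by
  let C' := (ofFSC C hN hC).toFSC hN
  let e : C.Combined S → C'.Combined S := fun c => (Fin.castLE hC c.1, c.2)
  have he : Function.Injective e := by
    rintro ⟨q, s⟩ ⟨q', s'⟩ h
    rw [Prod.mk.injEq] at h ⊢
    exact ⟨Fin.castLE_injective hC h.1, h.2⟩
  have hstep : ∀ c c', C.Step P.env c c' → C'.Step P.env (e c) (e c') ∧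
      C'.responseProb P.env (e c) (e c').2 = C.responseProb P.env c c'.2 := by
    rintro c c' ⟨a, hγ, hδ, hp⟩
    have h := ofFSC_castLE_act C hN hC hγ hδ
    refine ⟨⟨a, ?_, ?_, hp⟩, ?_⟩
    · simp [C', Ctrl.toFSC, e, h]
    · simp [C', Ctrl.toFSC, e, h]
    · simp [FSC.responseProb, C', Ctrl.toFSC, e, h, hγ]
  have hgoal : ∀ h, C.IsGoalHistory P h → C'.IsGoalHistory P (h.map e) := by
    rintro h ⟨⟨hhead, hchain⟩, c, hlast, hγ, hc⟩
    refine ⟨⟨?_, ?_⟩, e c, ?_, ?_, hc⟩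
    · rw [List.head?_map, hhead]
      rfl
    · exact List.isChain_map_of_isChain e (fun a b hab => (hstep a b hab).1) hchain
    · rw [List.getLast?_map, hlast]
      rfl
    · simp [C', Ctrl.toFSC, e, ofFSC_castLE_halt C hN hC hγ]
  have hlik : ∀ h, h.IsChain (C.Step P.env) →
      C.likelihood P.env h = C'.likelihood P.env (h.map e) := by
    intro h
    induction h with
    | nil => simp [FSC.likelihood]
    | cons c h ih =>
      rcases h with _ | ⟨c', h⟩
      · simp [FSC.likelihood]
      · intro hch
        rw [List.isChain_cons_cons] at hch
        simp only [List.map_cons, FSC.likelihood] at ih ⊢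
        rw [ih hch.2, (hstep c c' hch.1).2]
  let g : {h // C.IsGoalHistory P h} → {h // C'.IsGoalHistory P h} :=
    fun h => ⟨h.1.map e, hgoal h.1 h.2⟩
  have hg : Function.Injective g := fun h h' hh =>
    Subtype.ext (List.map_injective_iff.2 he (congrArg Subtype.val hh))
  calc C.LGT P = ∑' h : {h // C.IsGoalHistory P h}, C'.likelihood P.env (g h).1 :=
        tsum_congr fun h => hlik h.1 h.2.1.2
    _ ≤ _ := ENNReal.tsum_comp_le_tsum_of_injective hg _

end

end Pandor

namespace Pandor

variable {S A O : Type*} {N : ℕ}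

/-! ### Bounds on the values of the combined states -/

/-- Every transition of `C` is a transition of `C'`. -/
def Ctrl.IsSub (C C' : Ctrl A O N) : Prop := ∀ q o x, C q o = some x → C' q o = some x

theorem Ctrl.IsSub.refl (C : Ctrl A O N) : C.IsSub C := fun _ _ _ h => h

theorem Ctrl.IsSub.trans {C C' C'' : Ctrl A O N} (h : C.IsSub C') (h' : C'.IsSub C'') :
    C.IsSub C'' := fun q o x hx => h' q o x (h q o x hx)

theorem Ctrl.isSub_extend {C : Ctrl A O N} {q : Fin N} {o : O} (h : C q o = none)
    (x : ControlAction A × Fin N) : C.IsSub (C.extend q o x) := by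
  intro q' o' y hy
  unfold Ctrl.extend
  split_ifs with heq
  · rw [heq.1, heq.2, h] at hy
    cases hy
  · exact hy

theorem Ctrl.extend_self (C : Ctrl A O N) (q : Fin N) (o : O) (x : ControlAction A × Fin N) :
    C.extend q o x q o = some x := by
  simp [Ctrl.extend]

theorem Ctrl.IsSub.extend {C C' : Ctrl A O N} (h : C.IsSub C') {q : Fin N} {o : O}
    {x : ControlAction A × Fin N} (hx : C' q o = some x) : (C.extend q o x).IsSub C' := by
  intro q' o' y hy
  unfold Ctrl.extend at hy
  split_ifs at hy with heq
  · rw [heq.1, heq.2, hx, hy]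
  · exact h q' o' y hy

/-- The function `f` is an upper bound for the value of the runs of every controller that contains
`C`; where it is smaller than the value of non-termination, it decreases in expectation. -/
structure IsBound [Fintype S] (P : PlanningProblem S A O) (C : Ctrl A O N) (w : Reward) (ε : ℝ)
    (f : Fin N × S → ℝ) : Prop where
  goal_nonneg : 0 ≤ w.goal
  fail_nonneg : 0 ≤ w.fail
  noter_nonneg : 0 ≤ w.noter
  pos : 0 < ε
  nonneg : ∀ c, 0 ≤ f c
  goal : ∀ q s q', C q (P.env.Ω s) = some (.halt, q') → s ∈ P.goals → w.goal ≤ f (q, s)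
  fail : ∀ q s q', C q (P.env.Ω s) = some (.halt, q') → s ∉ P.goals → w.fail ≤ f (q, s)
  act : ∀ q s a q', C q (P.env.Ω s) = some (.act a, q') →
    ∑ s', (P.env.Δ s a s').toReal * f (q', s') + ε * max 0 (w.noter - f (q, s)) ≤ f (q, s)

section

variable [Fintype S] {P : PlanningProblem S A O} {C C' : Ctrl A O N} {w : Reward} {ε : ℝ}
  {f : Fin N × S → ℝ}

/-- Fewer transitions impose fewer constraints. A bound for a completed controller thus applies
while only part of it has been chosen. -/
theorem IsBound.mono (h : IsBound P C' w ε f) (hC : C.IsSub C') : IsBound P C w ε f where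
  goal_nonneg := h.goal_nonneg
  fail_nonneg := h.fail_nonneg
  noter_nonneg := h.noter_nonneg
  pos := h.pos
  nonneg := h.nonneg
  goal q s q' hc := h.goal q s q' (hC _ _ _ hc)
  fail q s q' hc := h.fail q s q' (hC _ _ _ hc)
  act q s a q' hc := h.act q s a q' (hC _ _ _ hc)

/-- Non-termination has value 0 and the likelihood is nonnegative, so the strict-decrease term
vanishes and any positive `ε` would do. -/
theorem isBound_discounted_one (P : PlanningProblem S A O) (C : Ctrl A O N) :
    IsBound P C ⟨1, 0, 0⟩ 1 (discounted P C 1) := by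
  classical
  have h0 := discounted_nonneg P C zero_le_one
  constructor
  · simp
  · simp
  · simp
  · simp
  · exact h0
  · intro q s q' hc hs
    rw [discounted_of_halt zero_le_one le_rfl hc, if_pos hs]
  · exact fun q s _ _ _ => h0 (q, s)
  · intro q s a q' hc
    rw [discounted_of_act zero_le_one le_rfl hc, one_mul, max_eq_left]
    · simp
    · have := h0 (q, s)
      rw [discounted_of_act zero_le_one le_rfl hc] at this
      simpa using this

theorem isBound_one_sub_discounted (P : PlanningProblem S A O) (C : Ctrl A O N) {β : ℝ}
    (h0 : 0 < β) (h1 : β < 1) :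
    IsBound P C ⟨0, 1, 1⟩ (1 - β) (fun c => 1 - discounted P C β c) := by
  classical
  have hle := discounted_le_one P C h0.le h1.le
  have hnn := discounted_nonneg P C h0.le
  constructor
  · simp
  · simp
  · simp
  · linarith
  · exact fun c => sub_nonneg.2 (hle c)
  · exact fun q s _ _ _ => sub_nonneg.2 (hle (q, s))
  · intro q s q' hc hs
    rw [discounted_of_halt h0.le h1.le hc, if_neg hs, sub_zero]
  · intro q s a q' hc
    have hsum : ∑ s', (P.env.Δ s a s').toReal * (1 - discounted P C β (q', s'))
        = 1 - ∑ s', (P.env.Δ s a s').toReal * discounted P C β (q', s') := by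
      simp only [mul_sub, mul_one, Finset.sum_sub_distrib, sum_transition_toReal]
    have heq := discounted_of_act h0.le h1.le hc
    have hX : 0 ≤ ∑ s', (P.env.Δ s a s').toReal * discounted P C β (q', s') :=
      Finset.sum_nonneg fun s' _ => mul_nonneg ENNReal.toReal_nonneg (hnn _)
    rw [hsum, heq, max_eq_right]
    -- With `X` the expected discounted likelihood after the move, the claim is `1 - X + (1 - β) * β
    -- * X ≤ 1 - β * X`, that is, `0 ≤ (1 - β)² * X`.
    · nlinarith [mul_nonneg (sub_nonneg.2 h1.le) (mul_nonneg (sub_nonneg.2 h1.le) hX)]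
    · have := hnn (q, s)
      rw [heq] at this
      simpa using this

end

/-! ### The invariant of the search -/

/-- The values of the elements of the history. -/
def Hist.value (h : Hist S N) (f : Fin N × S → ℝ) (k : ℕ) : ℝ := (h.states.map f).getD k 0

/-- The value of a list of combined states, weighted by their probabilities. -/
def weightedSum (l : List ((Fin N × S) × ℝ)) (f : Fin N × S → ℝ) : ℝ :=
  (l.map fun e => e.2 * f e.1).sum

@[simp] theorem weightedSum_nil (f : Fin N × S → ℝ) : weightedSum [] f = 0 := rfl

@[simp] theorem weightedSum_cons (e : (Fin N × S) × ℝ) (l : List ((Fin N × S) × ℝ))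
    (f : Fin N × S → ℝ) : weightedSum (e :: l) f = e.2 * f e.1 + weightedSum l f := by
  simp [weightedSum]

theorem weightedSum_nonneg {l : List ((Fin N × S) × ℝ)} {f : Fin N × S → ℝ}
    (hl : ∀ e ∈ l, 0 < e.2) (hf : ∀ c, 0 ≤ f c) : 0 ≤ weightedSum l f :=
  List.sum_nonneg fun x hx => by
    obtain ⟨e, he, rfl⟩ := List.mem_map.1 hx
    exact mul_nonneg (hl e he).le (hf _)

section

variable (h : Hist S N) (e : (Fin N × S) × ℝ) (f : Fin N × S → ℝ)

theorem Hist.p_append_of_lt {k : ℕ} (hk : k < h.length) : Hist.p (h ++ [e]) k = h.p k := by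
  simp [Hist.p, List.getD_eq_getElem?_getD, List.getElem?_append_left, hk]

theorem Hist.p_append_length : Hist.p (h ++ [e]) h.length = e.2 := by
  simp [Hist.p, List.getD_eq_getElem?_getD]

theorem Hist.value_append_of_lt {k : ℕ} (hk : k < h.length) :
    Hist.value (h ++ [e]) f k = h.value f k := by
  simp [Hist.value, Hist.states, List.getD_eq_getElem?_getD, List.getElem?_append_left, hk]

theorem Hist.value_append_length : Hist.value (h ++ [e]) f h.length = f e.1 := by
  simp [Hist.value, Hist.states, List.getD_eq_getElem?_getD]

variable {h f}

theorem Hist.value_nonneg (hf : ∀ c, 0 ≤ f c) (k : ℕ) : 0 ≤ h.value f k := by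
  rw [Hist.value, List.getD_eq_getElem?_getD, List.getElem?_map]
  cases h.states[k]? <;> simp [hf]

variable (f)

theorem Hist.idxOf_lt [BEq (Fin N × S)] [LawfulBEq (Fin N × S)] {c : Fin N × S}
    (hc : c ∈ h.states) :
    h.states.idxOf c < h.length := by
  have := List.idxOf_lt_length_of_mem hc
  simpa [Hist.states] using this

theorem Hist.value_idxOf [BEq (Fin N × S)] [LawfulBEq (Fin N × S)] {c : Fin N × S}
    (hc : c ∈ h.states) :
    h.value f (h.states.idxOf c) = f c := by
  have := List.idxOf_lt_length_of_mem hc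
  rw [Hist.value, List.getD_eq_getElem _ _ (by simpa using this), List.getElem_map,
    List.getElem_idxOf]

end

section

variable {P : PlanningProblem S A O}

/-- The combined states that may follow when the action `a` is executed in `s`. -/
def successors (ord : SearchOrder P N) (q : Fin N) (s : S) (a : A) : List ((Fin N × S) × ℝ) :=
  (nextStates ord s a).map fun e => ((q, e.1), e.2)

theorem successors_pos (ord : SearchOrder P N) (q : Fin N) (s : S) (a : A) :
    ∀ e ∈ successors ord q s a, 0 < e.2 := by
  intro e he
  simp only [successors, nextStates, List.map_map, List.mem_map] at he
  obtain ⟨s', hs', rfl⟩ := he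
  exact ENNReal.toReal_pos ((ord.mem_outcomes s a s').1 hs').ne' (PMF.apply_ne_top _ _)

end

/-- The invariant of the search with current history `h`, where `ρ k` lists the combined states that
are still to be visited after the first `k` elements of the history. -/
structure Inv [Fintype S] (P : PlanningProblem S A O) (c₀ : Fin N × S) (C : Ctrl A O N)
    (h : Hist S N) (α : Alpha) (ρ : ℕ → List ((Fin N × S) × ℝ)) : Prop where
  goal_nonneg : ∀ k ≤ h.length, 0 ≤ α.goal k
  fail_nonneg : ∀ k ≤ h.length, 0 ≤ α.fail k
  noter_nonneg : ∀ k ≤ h.length, 0 ≤ α.noter k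
  loop_nonneg : ∀ i k, i ≤ k → k < h.length → 0 ≤ α.loop i k
  p_pos : ∀ k < h.length, 0 < h.p k
  pos : ∀ k ≤ h.length, ∀ e ∈ ρ k, 0 < e.2
  bounded : ∀ w ε f, IsBound P C w ε f → α.Bounded w ε (f c₀) h.length h.p (h.value f)
    fun k => weightedSum (ρ k) f
  root_mass : α.goal 0 + α.fail 0 + α.noter 0 + (if 0 < h.length then h.p 0 else 0)
    + weightedSum (ρ 0) (fun _ => 1) = 1
  mass : ∀ k < h.length, α.goal (k + 1) + α.fail (k + 1) + α.noter (k + 1)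
    + ∑ i ∈ Finset.range (k + 1), α.loop i k + (if k + 1 < h.length then h.p (k + 1) else 0)
    + weightedSum (ρ (k + 1)) (fun _ => 1) = 1

section

variable [Fintype S] {P : PlanningProblem S A O} {c₀ : Fin N × S} {C C' : Ctrl A O N}
  {h : Hist S N} {α α' : Alpha} {ρ ρ' : ℕ → List ((Fin N × S) × ℝ)}

/-- The invariant quantifies over all bounds for the controller, and adding transitions shrinks this
class. -/
theorem Inv.mono (hI : Inv P c₀ C h α ρ) (hC : C.IsSub C') : Inv P c₀ C' h α ρ :=
  { hI with bounded := fun w ε f hf => hI.bounded w ε f (hf.mono hC) }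

theorem Inv.congr (hI : Inv P c₀ C h α ρ) (hρ : ∀ k ≤ h.length, ρ k = ρ' k) :
    Inv P c₀ C h α ρ' where
  goal_nonneg := hI.goal_nonneg
  fail_nonneg := hI.fail_nonneg
  noter_nonneg := hI.noter_nonneg
  loop_nonneg := hI.loop_nonneg
  p_pos := hI.p_pos
  pos k hk := hρ k hk ▸ hI.pos k hk
  bounded w ε f hf := by
    have hb := hI.bounded w ε f hf
    constructor
    · rw [← hρ 0 (Nat.zero_le _)]
      exact hb.root
    · intro k hk
      rw [← hρ (k + 1) hk]
      exact hb.level k hk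
  root_mass := hρ 0 (Nat.zero_le _) ▸ hI.root_mass
  mass k hk := hρ (k + 1) hk ▸ hI.mass k hk

theorem Inv.valid (hI : Inv P c₀ C h α ρ) : α.Valid h.length h.p where
  goal_nonneg := hI.goal_nonneg
  fail_nonneg := hI.fail_nonneg
  noter_nonneg := hI.noter_nonneg
  loop_nonneg := hI.loop_nonneg
  p_pos := hI.p_pos
  mass k hk := by
    have h1 := hI.mass k hk
    have h2 := weightedSum_nonneg (hI.pos (k + 1) hk)
      (f := fun _ : Fin N × S => (1 : ℝ)) fun _ => zero_le_one
    linarith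

theorem Inv.lambda_le (hI : Inv P c₀ C h α ρ) {w : Reward} {ε : ℝ} {f : Fin N × S → ℝ}
    (hf : IsBound P C w ε f) :
    w.goal * (calcLambda h α).goal + w.fail * (calcLambda h α).fail
      + w.noter * (calcLambda h α).noter ≤ f c₀ :=
  hI.valid.lambda_le hf.pos (fun k hk => weightedSum_nonneg (hI.pos k hk) hf.nonneg)
    (hI.bounded w ε f hf)

/-- `λ_goal` is a lower bound for the likelihood of goal termination. -/
theorem Inv.lambda_goal_le (hI : Inv P c₀ C h α ρ) :
    (calcLambda h α).goal ≤ discounted P C 1 c₀ := by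
  have := hI.lambda_le (isBound_discounted_one P C)
  simpa using this

/-- `1 - λ_fail - λ_noter` is an upper bound for the likelihood of goal termination. -/
theorem Inv.le_one_sub_lambda (hI : Inv P c₀ C h α ρ) (hC : C.IsSub C') :
    discounted P C' 1 c₀ ≤ 1 - (calcLambda h α).fail - (calcLambda h α).noter := by
  refine discounted_one_le_of_forall fun β h0 h1 => ?_
  -- The bound is computed from the completion `C'` but used for the partial controller `C`, so the
  -- estimate holds for every completion at once.
  have := hI.lambda_le ((isBound_one_sub_discounted P C' h0 h1).mono hC)
  simp only [zero_mul, zero_add, one_mul] at this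
  linarith

theorem Alpha.reward_nonneg {w : Reward} {k : ℕ} (hw : IsBound P C w ε f)
    (hI : Inv P c₀ C h α ρ) (hk : k ≤ h.length) : 0 ≤ α.reward w k :=
  add_nonneg (add_nonneg (mul_nonneg hw.goal_nonneg (hI.goal_nonneg k hk))
    (mul_nonneg hw.fail_nonneg (hI.fail_nonneg k hk)))
    (mul_nonneg hw.noter_nonneg (hI.noter_nonneg k hk))

-- Preservation of the invariant by recording, extending and shortening

/-- The invariant is preserved when the outcome of the next combined state is recorded. -/
theorem Inv.record {c : Fin N × S} {p : ℝ} {rest : List ((Fin N × S) × ℝ)}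
    (hI : Inv P c₀ C h α ρ) (hρ : ρ h.length = (c, p) :: rest)
    (hlt : ∀ k < h.length, α'.goal k = α.goal k ∧ α'.fail k = α.fail k ∧ α'.noter k = α.noter k)
    (hloop : ∀ i k, k + 1 ≠ h.length → α'.loop i k = α.loop i k)
    (hgoal : 0 ≤ α'.goal h.length) (hfail : 0 ≤ α'.fail h.length)
    (hnoter : 0 ≤ α'.noter h.length)
    (hloop' : ∀ i k, i ≤ k → k + 1 = h.length → 0 ≤ α'.loop i k)
    (hbound : ∀ w ε f, IsBound P C w ε f → α'.reward w h.length
      + ∑ i ∈ Finset.range h.length, α'.loop i (h.length - 1) * h.value f i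
      ≤ α.reward w h.length
      + ∑ i ∈ Finset.range h.length, α.loop i (h.length - 1) * h.value f i + p * f c)
    (hmass : α'.goal h.length + α'.fail h.length + α'.noter h.length
      + ∑ i ∈ Finset.range h.length, α'.loop i (h.length - 1)
      = α.goal h.length + α.fail h.length + α.noter h.length
      + ∑ i ∈ Finset.range h.length, α.loop i (h.length - 1) + p) :
    Inv P c₀ C h α' (Function.update ρ h.length rest) where
  goal_nonneg k hk := by
    rcases hk.lt_or_eq with hk | rfl
    · rw [(hlt k hk).1]
      exact hI.goal_nonneg k hk.le
    · exact hgoal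
  fail_nonneg k hk := by
    rcases hk.lt_or_eq with hk | rfl
    · rw [(hlt k hk).2.1]
      exact hI.fail_nonneg k hk.le
    · exact hfail
  noter_nonneg k hk := by
    rcases hk.lt_or_eq with hk | rfl
    · rw [(hlt k hk).2.2]
      exact hI.noter_nonneg k hk.le
    · exact hnoter
  loop_nonneg i k hik hk := by
    by_cases hkn : k + 1 = h.length
    · exact hloop' i k hik hkn
    · rw [hloop i k hkn]
      exact hI.loop_nonneg i k hik hk
  p_pos := hI.p_pos
  pos k hk e he := by
    rcases hk.lt_or_eq with hk | rfl
    · rw [Function.update_of_ne hk.ne] at he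
      exact hI.pos k hk.le e he
    · rw [Function.update_self] at he
      exact hI.pos _ le_rfl e (by rw [hρ]; exact List.mem_cons_of_mem _ he)
  bounded w ε f hf := by
    have hb := hI.bounded w ε f hf
    have hbd := hbound w ε f hf
    have hrew : ∀ k < h.length, α'.reward w k = α.reward w k := fun k hk => by
      simp only [Alpha.reward, hlt k hk]
    constructor
    · have hr := hb.root
      -- For the empty history the truncated index `h.length - 1` is harmless, because the sums over
      -- `range h.length` are empty.
      rcases Nat.eq_zero_or_pos h.length with h0 | h0
      · rw [h0] at hbd hρ hr ⊢
        rw [hρ] at hr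
        simp at hbd hr ⊢
        linarith
      · rw [hrew 0 h0, Function.update_of_ne h0.ne]
        exact hr
    · intro k hk
      have hl := hb.level k hk
      by_cases hkn : k + 1 = h.length
      · rw [hkn, hρ, weightedSum_cons] at hl
        have hk' : h.length - 1 = k := by omega
        rw [hk'] at hbd
        rw [hkn, Function.update_self]
        dsimp only at hl
        linarith
      · rw [hrew (k + 1) (by omega), Function.update_of_ne hkn]
        simpa only [hloop _ k hkn] using hl
  root_mass := by
    have hr := hI.root_mass
    rcases Nat.eq_zero_or_pos h.length with h0 | h0
    · rw [h0] at hmass hρ hr ⊢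
      rw [hρ] at hr
      simp at hmass hr ⊢
      linarith
    · obtain ⟨h1, h2, h3⟩ := hlt 0 h0
      rw [h1, h2, h3, Function.update_of_ne h0.ne]
      exact hr
  mass k hk := by
    have hl := hI.mass k hk
    by_cases hkn : k + 1 = h.length
    · rw [hkn, hρ, weightedSum_cons] at hl
      have hk' : h.length - 1 = k := by omega
      rw [hk'] at hmass
      rw [hkn, Function.update_self]
      dsimp only at hl
      linarith
    · obtain ⟨h1, h2, h3⟩ := hlt (k + 1) (by omega)
      rw [h1, h2, h3, Function.update_of_ne hkn]
      simpa only [hloop _ k hkn] using hl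

theorem Inv.addStop {q q' : Fin N} {s : S} {p : ℝ} {rest : List ((Fin N × S) × ℝ)}
    (hI : Inv P c₀ C h α ρ) (hρ : ρ h.length = ((q, s), p) :: rest)
    (hC : C q (P.env.Ω s) = some (.halt, q')) :
    Inv P c₀ C h (α.addStop P h s p) (Function.update ρ h.length rest) := by
  have hp : 0 < p := hI.pos _ le_rfl ((q, s), p) (by simp [hρ])
  have hg := hI.goal_nonneg _ le_rfl
  have hf := hI.fail_nonneg _ le_rfl
  have hn := hI.noter_nonneg _ le_rfl
  have hloop : ∀ i k, i ≤ k → k + 1 = h.length → 0 ≤ α.loop i k := fun i k hik hk =>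
    hI.loop_nonneg i k hik (by omega)
  unfold Alpha.addStop
  split_ifs with hs
  · refine hI.record hρ ?_ ?_ ?_ ?_ ?_ ?_ ?_ ?_
    · intro k hk
      simp [Function.update_of_ne hk.ne]
    · simp
    · dsimp only
      rw [Function.update_self]
      linarith
    · exact hf
    · exact hn
    · exact hloop
    · intro w ε f hw
      have := mul_le_mul_of_nonneg_left (hw.goal q s q' hC hs) hp.le
      simp only [Alpha.reward, Function.update_self]
      linarith
    · simp only [Function.update_self]
      ring
  · refine hI.record hρ ?_ ?_ ?_ ?_ ?_ ?_ ?_ ?_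
    · intro k hk
      simp [Function.update_of_ne hk.ne]
    · simp
    · exact hg
    · dsimp only
      rw [Function.update_self]
      linarith
    · exact hn
    · exact hloop
    · intro w ε f hw
      have := mul_le_mul_of_nonneg_left (hw.fail q s q' hC hs) hp.le
      simp only [Alpha.reward, Function.update_self]
      linarith
    · simp only [Function.update_self]
      ring

/-- The recorded outcomes and loops contribute nonnegative values and can be dropped. What is left
is superharmonicity along the history, to be iterated around a loop. -/
theorem Inv.move_le {w : Reward} {ε : ℝ} {f : Fin N × S → ℝ} (hI : Inv P c₀ C h α ρ)
    (hw : IsBound P C w ε f) {k : ℕ} (hk : k < h.length) :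
    (if k + 1 < h.length then h.p (k + 1) * h.value f (k + 1) else 0)
      + weightedSum (ρ (k + 1)) f + ε * max 0 (w.noter - h.value f k) ≤ h.value f k := by
  have h1 := (hI.bounded w ε f hw).level k hk
  have h2 := Alpha.reward_nonneg hw hI (Nat.succ_le_of_lt hk)
  have h3 : 0 ≤ ∑ i ∈ Finset.range (k + 1), α.loop i k * h.value f i :=
    Finset.sum_nonneg fun i hi => mul_nonneg
      (hI.loop_nonneg i k (Nat.lt_succ_iff.1 (Finset.mem_range.1 hi)) hk)
      (Hist.value_nonneg hw.nonneg i)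
  simp only [Nat.succ_eq_add_one] at h2
  linarith

/-- A loop of likelihood `1` has at least the value of non-termination. -/
theorem Inv.noter_le {w : Reward} {ε : ℝ} {f : Fin N × S → ℝ} {c : Fin N × S} {p : ℝ}
    {rest : List ((Fin N × S) × ℝ)} {k : ℕ} (hI : Inv P c₀ C h α ρ)
    (hρ : ρ h.length = (c, p) :: rest) (hw : IsBound P C w ε f) (hk : k < h.length)
    (hc : h.value f k = f c) (hloop : 1 ≤ (∏ j ∈ Finset.Ioo k h.length, h.p j) * p) :
    w.noter ≤ f c := by
  have hv := fun j => Hist.value_nonneg (h := h) hw.nonneg j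
  have hrest : 0 ≤ weightedSum rest f := weightedSum_nonneg
    (fun e he => hI.pos _ le_rfl e (by rw [hρ]; exact List.mem_cons_of_mem _ he)) hw.nonneg
  have hmax : ∀ j, 0 ≤ ε * max 0 (w.noter - h.value f j) := fun j =>
    mul_nonneg hw.pos.le (le_max_left _ _)
  obtain ⟨m, hm⟩ : ∃ m, h.length = m + 1 := ⟨h.length - 1, by omega⟩
  have hlast := hI.move_le hw (k := m) (by omega)
  rw [← hm, hρ, weightedSum_cons, if_neg (lt_irrefl _)] at hlast
  dsimp only at hlast
  -- Going once around the loop loses at least the decrease at `h⁽ᵏ⁾`. As the loop has likelihood at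
  -- least 1 and returns to the same value `f c`, this decrease must be zero.
  have hkey : (∏ j ∈ Finset.Ioo k h.length, h.p j) * p * f c
      + ε * max 0 (w.noter - h.value f k) ≤ h.value f k := by
    have hIoo : Finset.Ioo k h.length = Finset.Ioc k m := by
      ext j
      simp only [Finset.mem_Ioo, Finset.mem_Ioc]
      omega
    rw [hIoo]
    rcases (show k ≤ m by omega).eq_or_lt with rfl | hkm
    · rw [Finset.Ioc_self, Finset.prod_empty, one_mul]
      linarith
    · have hchain : ∀ j, k + 1 ≤ j → j ≤ m →
          (∏ i ∈ Finset.Ioc k j, h.p i) * h.value f j ≤ h.p (k + 1) * h.value f (k + 1) := by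
        intro j hj
        induction j, hj using Nat.le_induction with
        | base => simp
        | succ j hj ih =>
          intro hjm
          refine le_trans ?_ (ih (by omega))
          rw [Finset.prod_Ioc_succ_top (by omega), mul_assoc]
          have hmove := hI.move_le hw (k := j) (by omega)
          rw [if_pos (by omega)] at hmove
          have hres := weightedSum_nonneg (hI.pos (j + 1) (by omega)) hw.nonneg
          refine mul_le_mul_of_nonneg_left (by linarith [hmax j]) ?_
          refine Finset.prod_nonneg fun i hi => (hI.p_pos i ?_).le
          have := Finset.mem_Ioc.1 hi
          omega
      have hfirst := hI.move_le hw hk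
      rw [if_pos (by omega)] at hfirst
      have hres := weightedSum_nonneg (hI.pos (k + 1) (by omega)) hw.nonneg
      have hprod : 0 ≤ ∏ i ∈ Finset.Ioc k m, h.p i := Finset.prod_nonneg fun i hi =>
        (hI.p_pos i (by have := Finset.mem_Ioc.1 hi; omega)).le
      have hend : p * f c ≤ h.value f m := by linarith [hmax m]
      have := mul_le_mul_of_nonneg_left hend hprod
      linarith [hchain m (by omega) le_rfl]
  rw [hc] at hkey
  have h1 := mul_le_mul_of_nonneg_right hloop (hw.nonneg c)
  by_contra hlt
  push Not at hlt
  have h2 : 0 < ε * max 0 (w.noter - f c) :=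
    mul_pos hw.pos (lt_max_of_lt_right (sub_pos.2 hlt))
  linarith

/-- A decaying loop trades the pending value `p * f c` for `p` times the equal value of `h⁽ᵏ⁾`;
otherwise `noter_le` makes `p * w.noter` an admissible replacement. -/
theorem Inv.addLoop [BEq (Fin N × S)] [LawfulBEq (Fin N × S)] {c : Fin N × S} {p : ℝ}
    {rest : List ((Fin N × S) × ℝ)}
    (hI : Inv P c₀ C h α ρ) (hρ : ρ h.length = (c, p) :: rest) (hc : c ∈ h.states) :
    Inv P c₀ C h (α.addLoop h (h.states.idxOf c) p) (Function.update ρ h.length rest) := by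
  have hp : 0 < p := hI.pos _ le_rfl (c, p) (by simp [hρ])
  have hg := hI.goal_nonneg _ le_rfl
  have hf := hI.fail_nonneg _ le_rfl
  have hn := hI.noter_nonneg _ le_rfl
  have hloop : ∀ i k, i ≤ k → k + 1 = h.length → 0 ≤ α.loop i k := fun i k hik hk =>
    hI.loop_nonneg i k hik (by omega)
  have hk := Hist.idxOf_lt hc
  have hv := fun f => Hist.value_idxOf f hc
  generalize h.states.idxOf c = k at hk hv
  unfold Alpha.addLoop
  split_ifs with hlt
  · have hsum : ∀ F : ℕ → ℝ, ∑ i ∈ Finset.range h.length,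
        (if i = k ∧ h.length - 1 + 1 = h.length then α.loop i (h.length - 1) + p
          else α.loop i (h.length - 1)) * F i
        = ∑ i ∈ Finset.range h.length, α.loop i (h.length - 1) * F i + p * F k := by
      intro F
      have hterm : ∀ i, (if i = k ∧ h.length - 1 + 1 = h.length then α.loop i (h.length - 1) + p
          else α.loop i (h.length - 1)) * F i
          = α.loop i (h.length - 1) * F i + if i = k then p * F k else 0 := by
        intro i
        have : h.length - 1 + 1 = h.length := by omega
        by_cases hik : i = k
        · simp [hik, this]
          ring
        · simp [hik]
      simp only [hterm, Finset.sum_add_distrib, Finset.sum_ite_eq', Finset.mem_range, hk, if_true]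
    refine hI.record hρ ?_ ?_ hg hf hn ?_ ?_ ?_
    · simp
    · intro i j hj
      simp [hj]
    · intro i j hij hj
      have := hloop i j hij hj
      dsimp only
      split_ifs
      · linarith
      · exact this
    · intro w ε f hw
      have := hsum (h.value f)
      rw [hv] at this
      simp only [this]
      simp only [Alpha.reward]
      linarith
    · have := hsum fun _ => 1
      simp only [mul_one] at this
      simp only [this]
      ring
  · refine hI.record hρ ?_ ?_ hg hf ?_ hloop ?_ ?_
    · intro j hj
      simp [Function.update_of_ne hj.ne]
    · simp
    · dsimp only
      rw [Function.update_self]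
      linarith
    · intro w ε f hw
      have := mul_le_mul_of_nonneg_left
        (hI.noter_le hρ hw hk (hv f) (not_lt.1 hlt)) hp.le
      simp only [Alpha.reward, Function.update_self]
      linarith
    · simp only [Function.update_self]
      ring

/-- The list has no repetitions, and the states it omits have probability zero. -/
theorem weightedSum_successors (ord : SearchOrder P N) (q : Fin N) (s : S) (a : A)
    (f : Fin N × S → ℝ) :
    weightedSum (successors ord q s a) f = ∑ s', (P.env.Δ s a s').toReal * f (q, s') := by
  classical
  have h1 : weightedSum (successors ord q s a) f
      = ((ord.outcomes s a).map fun s' => (P.env.Δ s a s').toReal * f (q, s')).sum := by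
    simp [weightedSum, successors, nextStates, Function.comp_def]
  rw [h1, ← List.sum_toFinset _ (ord.outcomes_nodup s a)]
  refine Finset.sum_subset (Finset.subset_univ _) fun s' _ hs' => ?_
  rw [List.mem_toFinset, ord.mem_outcomes, not_lt, nonpos_iff_eq_zero] at hs'
  simp [hs']

/-- The pending term `p * f (q, s)` of the old top level becomes the term of the new history
element, so the old inequalities keep their totals. Only the new level needs an argument. -/
theorem Inv.push (ord : SearchOrder P N) {q q' : Fin N} {s : S} {p : ℝ} {a : A}
    {rest : List ((Fin N × S) × ℝ)} (hI : Inv P c₀ C h α ρ)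
    (hρ : ρ h.length = ((q, s), p) :: rest) (hC : C q (P.env.Ω s) = some (.act a, q')) :
    Inv P c₀ C (h ++ [((q, s), p)]) (α.push h.length)
      (Function.update (Function.update ρ h.length rest) (h.length + 1)
        (successors ord q' s a)) := by
  have hp : 0 < p := hI.pos _ le_rfl ((q, s), p) (by simp [hρ])
  have hlen : (h ++ [((q, s), p)]).length = h.length + 1 := by simp
  have hupd : ∀ u : ℕ → ℝ, (∀ k ≤ h.length, 0 ≤ u k) →
      ∀ k ≤ h.length + 1, 0 ≤ Function.update u (h.length + 1) 0 k := by
    intro u hu k hk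
    rcases hk.lt_or_eq with hk | rfl
    · rw [Function.update_of_ne hk.ne]
      exact hu k (by omega)
    · simp
  have hrew : ∀ w : Reward, ∀ k ≤ h.length,
      (α.push h.length).reward w k = α.reward w k := by
    intro w k hk
    have : k ≠ h.length + 1 := by omega
    simp [Alpha.reward, Alpha.push, Function.update_of_ne this]
  have hloop : ∀ i k, i ≤ k → k < h.length → (α.push h.length).loop i k = α.loop i k := by
    intro i k hik hk
    have h1 : i ≠ h.length := by omega
    simp [Alpha.push, hk.ne, h1]
  have hloop' : ∀ i, (α.push h.length).loop i h.length = 0 := by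
    intro i
    simp [Alpha.push]
  have hρ1 : ∀ k < h.length, Function.update (Function.update ρ h.length rest) (h.length + 1)
        (successors ord q' s a) k = ρ k := by
    intro k hk
    rw [Function.update_of_ne (by omega), Function.update_of_ne (by omega)]
  have hρ2 : Function.update (Function.update ρ h.length rest) (h.length + 1)
        (successors ord q' s a) h.length = rest := by
    rw [Function.update_of_ne (by omega), Function.update_self]
  constructor
  · rw [hlen]
    exact hupd _ hI.goal_nonneg
  · rw [hlen]
    exact hupd _ hI.fail_nonneg
  · rw [hlen]
    exact hupd _ hI.noter_nonneg
  · rw [hlen]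
    intro i k hik hk
    rcases (Nat.lt_succ_iff.1 hk).lt_or_eq with hk | rfl
    · rw [hloop i k hik hk]
      exact hI.loop_nonneg i k hik hk
    · rw [hloop']
  · rw [hlen]
    intro k hk
    rcases (Nat.lt_succ_iff.1 hk).lt_or_eq with hk | rfl
    · rw [Hist.p_append_of_lt h _ hk]
      exact hI.p_pos k hk
    · rw [Hist.p_append_length]
      exact hp
  · rw [hlen]
    intro k hk e he
    rcases hk.lt_or_eq with hk | rfl
    · rcases (Nat.lt_succ_iff.1 hk).lt_or_eq with hk | rfl
      · rw [hρ1 k hk] at he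
        exact hI.pos k hk.le e he
      · rw [hρ2] at he
        exact hI.pos _ le_rfl e (by rw [hρ]; exact List.mem_cons_of_mem _ he)
    · rw [Function.update_self] at he
      exact successors_pos ord q' s a e he
  · intro w ε f hf
    have hb := hI.bounded w ε f hf
    rw [hlen]
    constructor
    · have hr := hb.root
      rw [if_pos (Nat.succ_pos _), hrew w 0 (Nat.zero_le _)]
      rcases Nat.eq_zero_or_pos h.length with h0 | h0
      · have h1 := Hist.p_append_length h ((q, s), p)
        have h2 := Hist.value_append_length h ((q, s), p) f
        rw [h0] at h1 h2 hρ2 hρ hr ⊢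
        rw [h1, h2, hρ2]
        rw [hρ, weightedSum_cons, if_neg (lt_irrefl _)] at hr
        dsimp only at hr ⊢
        linarith
      · rw [Hist.p_append_of_lt h _ h0, Hist.value_append_of_lt h _ f h0, hρ1 0 h0]
        rw [if_pos h0] at hr
        exact hr
    · intro k hk
      rcases (Nat.lt_succ_iff.1 hk).lt_or_eq with hk | rfl
      · have hl := hb.level k hk
        have hsum : ∑ i ∈ Finset.range (k + 1),
            (α.push h.length).loop i k * Hist.value (h ++ [((q, s), p)]) f i
            = ∑ i ∈ Finset.range (k + 1), α.loop i k * h.value f i := by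
          refine Finset.sum_congr rfl fun i hi => ?_
          have hi := Finset.mem_range.1 hi
          rw [hloop i k (by omega) hk, Hist.value_append_of_lt h _ f (by omega)]
        rw [hsum, hrew w (k + 1) (by omega), if_pos (by omega : k + 1 < h.length + 1),
          Hist.value_append_of_lt h _ f hk]
        by_cases hkn : k + 1 = h.length
        · rw [hkn, hρ, weightedSum_cons, if_neg (lt_irrefl _)] at hl
          rw [hkn, hρ2, Hist.p_append_length, Hist.value_append_length]
          dsimp only at hl ⊢
          linarith
        · have hkn : k + 1 < h.length := by omega
          rw [hρ1 _ hkn, Hist.p_append_of_lt h _ hkn, Hist.value_append_of_lt h _ f hkn]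
          rw [if_pos hkn] at hl
          exact hl
      -- At the new level nothing is recorded and all successors are pending, so its inequality is
      -- exactly `IsBound.act`.
      · rw [if_neg (lt_irrefl _), Function.update_self, weightedSum_successors,
          Hist.value_append_length]
        simp only [hloop', zero_mul, Finset.sum_const_zero]
        have := hf.act q s a q' hC
        simpa [Alpha.reward, Alpha.push] using this
  · have hr := hI.root_mass
    have hz : (α.push h.length).goal 0 = α.goal 0 ∧ (α.push h.length).fail 0 = α.fail 0
        ∧ (α.push h.length).noter 0 = α.noter 0 := by
      simp [Alpha.push]
    rw [hlen, if_pos (Nat.succ_pos _), hz.1, hz.2.1, hz.2.2]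
    rcases Nat.eq_zero_or_pos h.length with h0 | h0
    · have h1 := Hist.p_append_length h ((q, s), p)
      rw [h0] at h1 hρ2 hρ hr ⊢
      rw [h1, hρ2]
      rw [hρ, weightedSum_cons, if_neg (lt_irrefl _)] at hr
      dsimp only at hr ⊢
      linarith
    · rw [Hist.p_append_of_lt h _ h0, hρ1 0 h0]
      rw [if_pos h0] at hr
      exact hr
  · rw [hlen]
    intro k hk
    rcases (Nat.lt_succ_iff.1 hk).lt_or_eq with hk | rfl
    · have hl := hI.mass k hk
      have hz : (α.push h.length).goal (k + 1) = α.goal (k + 1)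
          ∧ (α.push h.length).fail (k + 1) = α.fail (k + 1)
          ∧ (α.push h.length).noter (k + 1) = α.noter (k + 1) := by
        have hne : k + 1 ≠ h.length + 1 := by omega
        simp [Alpha.push, Function.update_of_ne hne]
      have hsum : ∑ i ∈ Finset.range (k + 1), (α.push h.length).loop i k
          = ∑ i ∈ Finset.range (k + 1), α.loop i k :=
        Finset.sum_congr rfl fun i hi =>
          hloop i k (by have := Finset.mem_range.1 hi; omega) hk
      rw [hsum, hz.1, hz.2.1, hz.2.2, if_pos (by omega : k + 1 < h.length + 1)]
      by_cases hkn : k + 1 = h.length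
      · rw [hkn, hρ, weightedSum_cons, if_neg (lt_irrefl _)] at hl
        rw [hkn, hρ2, Hist.p_append_length]
        dsimp only at hl ⊢
        linarith
      · have hkn : k + 1 < h.length := by omega
        rw [hρ1 _ hkn, Hist.p_append_of_lt h _ hkn]
        rw [if_pos hkn] at hl
        exact hl
    · rw [if_neg (lt_irrefl _), Function.update_self, weightedSum_successors]
      simp only [hloop', Finset.sum_const_zero, mul_one, sum_transition_toReal]
      simp [Alpha.push]

theorem Alpha.Bounded.congr {w : Reward} {ε b : ℝ} {n : ℕ} {p p' F F' r : ℕ → ℝ}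
    (hb : α.Bounded w ε b n p F r) (hp : ∀ k < n, p k = p' k) (hF : ∀ k < n, F k = F' k) :
    α.Bounded w ε b n p' F' r := by
  constructor
  · have := hb.root
    split_ifs at this ⊢ with h0
    · rwa [← hp 0 h0, ← hF 0 h0]
    · exact this
  · intro k hk
    have hl := hb.level k hk
    have hsum : ∑ i ∈ Finset.range (k + 1), α.loop i k * F' i
        = ∑ i ∈ Finset.range (k + 1), α.loop i k * F i :=
      Finset.sum_congr rfl fun i hi => by
        rw [hF i (by have := Finset.mem_range.1 hi; omega)]
    rw [hsum, ← hF k hk]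
    split_ifs at hl ⊢ with h0
    · rwa [← hp _ h0, ← hF _ h0]
    · exact hl

/-- That nothing is pending after `e` is essential: the mass of the last level is then exactly 1,
and `pop_mass` turns it into the full move probability. Otherwise mass would be lost. -/
theorem Inv.pop {e : (Fin N × S) × ℝ} (hI : Inv P c₀ C (h ++ [e]) α ρ)
    (hρ : ρ (h.length + 1) = []) : Inv P c₀ C h (cumulateAlpha (h ++ [e]) α) ρ := by
  have hlen : (h ++ [e]).length = h.length + 1 := by simp
  have hv := hI.valid
  rw [cumulateAlpha_eq_pop _ _ hlen]
  rw [hlen] at hv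
  have hv' := hv.pop
  have hpe := fun k hk => Hist.p_append_of_lt h e (k := k) hk
  have hlast := hI.mass h.length (by simp)
  rw [hlen, if_neg (lt_irrefl _), hρ, weightedSum_nil, add_zero, add_zero] at hlast
  have hpop := hv.pop_mass hlast
  constructor
  · exact hv'.goal_nonneg
  · exact hv'.fail_nonneg
  · exact hv'.noter_nonneg
  · exact hv'.loop_nonneg
  · exact fun k hk => hpe k hk ▸ hv'.p_pos k hk
  · exact fun k hk => hI.pos k (by omega)
  · intro w ε f hf
    have hb := hI.bounded w ε f hf
    rw [hlen] at hb
    refine (hb.pop hv hf.pos ?_).congr hpe fun k hk => Hist.value_append_of_lt h e f hk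
    simp [hρ]
  · have hr := hI.root_mass
    rw [hlen, if_pos (Nat.succ_pos _)] at hr
    rcases Nat.eq_zero_or_pos h.length with h0 | h0
    · rw [h0] at hpop ⊢
      simp only [Finset.range_zero, Finset.sum_empty, mul_zero, add_zero] at hpop
      rw [hpop, if_neg (lt_irrefl _)]
      linarith
    · rw [Alpha.pop_goal_of_lt h0, Alpha.pop_fail_of_lt h0, Alpha.pop_noter_of_lt h0, if_pos h0,
        ← hpe 0 h0]
      exact hr
  · intro k hk
    have hl := hI.mass k (by omega)
    rw [hlen, if_pos (by omega : k + 1 < h.length + 1)] at hl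
    rcases (Nat.succ_le_of_lt hk).lt_or_eq with hkn | hkn
    · rw [Alpha.pop_goal_of_lt hkn, Alpha.pop_fail_of_lt hkn, Alpha.pop_noter_of_lt hkn,
        if_pos hkn, ← hpe _ hkn]
      simpa only [Alpha.pop_loop_of_ne (p := Hist.p (h ++ [e])) (α := α) hkn.ne] using hl
    · simp only [Nat.succ_eq_add_one] at hkn
      rw [← hkn] at hpop ⊢
      have hsum : ∑ i ∈ Finset.range (k + 1), (α.pop (Hist.p (h ++ [e])) (k + 1)).loop i k
          = Hist.p (h ++ [e]) (k + 1)
              * ∑ i ∈ Finset.range (k + 1), α.visits (k + 1) * α.loop i (k + 1)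
            + ∑ i ∈ Finset.range (k + 1), α.loop i k := by
        rw [Finset.mul_sum, ← Finset.sum_add_distrib]
        exact Finset.sum_congr rfl fun i hi =>
          Alpha.pop_loop_succ (Nat.lt_succ_iff.1 (Finset.mem_range.1 hi))
      rw [hsum, if_neg (lt_irrefl _)]
      linarith

end

end Pandor

namespace Pandor

variable {S A O : Type*} {N : ℕ}

/-! ### Soundness and completeness of the two steps -/

/-- A successful branch returns a controller with a sufficient likelihood of goal termination, and a
branch that completes the step satisfies the postcondition `Q`. -/
def Outcome.Ok [Fintype S] (P : PlanningProblem S A O) (c₀ : Fin N × S) (L : ℝ)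
    (Q : Ctrl A O N → Alpha → Prop) : Outcome A O N → Prop
  | .success C => L ≤ discounted P C 1 c₀
  | .done C α => Q C α

/-- A branch that is successful or has chosen transitions of `C'` only. -/
def Outcome.Follows (C' : Ctrl A O N) : Outcome A O N → Prop
  | .success _ => True
  | .done C _ => C.IsSub C'

/-- A controller without undefined transitions that has a sufficient likelihood of goal
termination. -/
structure IsSolution [Fintype S] (P : PlanningProblem S A O) (c₀ : Fin N × S) (L : ℝ)
    (C : Ctrl A O N) : Prop where
  total : ∀ q o, C q o ≠ none
  le : L ≤ discounted P C 1 c₀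

section

variable [Fintype S] (P : PlanningProblem S A O) (ord : SearchOrder P N) (c₀ : Fin N × S) (L : ℝ)

/-- The OR-step with history `h` is sound and complete. -/
def OrSpec (h : Hist S N) : Prop :=
  ∀ (C : Ctrl A O N) (q : Fin N) (s : S) (p : ℝ) (α : Alpha)
    (ρ : ℕ → List ((Fin N × S) × ℝ)) (rest : List ((Fin N × S) × ℝ)), Inv P c₀ C h α ρ →
    ρ h.length = ((q, s), p) :: rest →
    (∀ r ∈ orStep P ord L C q s p h α, r.Ok P c₀ L fun C' α' =>
      C.IsSub C' ∧ Inv P c₀ C' h α' (Function.update ρ h.length rest)) ∧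
    ∀ C', C.IsSub C' → IsSolution P c₀ L C' → ∃ r ∈ orStep P ord L C q s p h α, r.Follows C'

/-- The AND-step with history `h` is sound and complete. -/
def AndSpec (h : Hist S N) : Prop :=
  ∀ (C : Ctrl A O N) (q : Fin N) (next : List (S × ℝ)) (α : Alpha)
    (ρ : ℕ → List ((Fin N × S) × ℝ)), Inv P c₀ C h α ρ →
    ρ h.length = next.map (fun e => ((q, e.1), e.2)) →
    (∀ r ∈ andStep P ord L C q next h α, r.Ok P c₀ L fun C' α' =>
      C.IsSub C' ∧ ∃ α₁, α' = cumulateAlpha h α₁ ∧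
        Inv P c₀ C' h α₁ (Function.update ρ h.length [])) ∧
    ∀ C', C.IsSub C' → IsSolution P c₀ L C' → ∃ r ∈ andStep P ord L C q next h α, r.Follows C'

variable {P ord c₀ L}

/-- The next states are consumed one by one from the pending list. The postcondition speaks of the
bookkeeping before `cumulateAlpha`, since the result belongs to the history without its last
element; the caller converts it by `Inv.pop`. -/
theorem OrSpec.andSpec {h : Hist S N} (hor : OrSpec P ord c₀ L h) : AndSpec P ord c₀ L h := by
  intro C q next
  induction next generalizing C with
  | nil =>
    intro α ρ hI hρ
    rw [andStep]
    refine ⟨?_, fun C' hC _ => ⟨_, List.mem_singleton_self _, hC⟩⟩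
    simp only [List.mem_singleton, forall_eq]
    refine ⟨Ctrl.IsSub.refl C, α, rfl, ?_⟩
    rw [List.map_nil] at hρ
    rwa [← hρ, Function.update_eq_self]
  | cons e next ih =>
    obtain ⟨s, p⟩ := e
    intro α ρ hI hρ
    rw [List.map_cons] at hρ
    obtain ⟨hsound, hcomp⟩ := hor C q s p α ρ _ hI hρ
    rw [andStep]
    constructor
    · intro r hr
      obtain ⟨r₁, hr₁, hr⟩ := List.mem_flatMap.1 hr
      have hok := hsound r₁ hr₁
      rcases r₁ with C₁ | ⟨C₁, α₁⟩
      · rw [List.mem_singleton.1 hr]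
        exact hok
      · obtain ⟨hsub, hinv⟩ := hok
        dsimp only at hr
        split_ifs at hr with hg hu
        · rw [List.mem_singleton.1 hr]
          exact hg.trans hinv.lambda_goal_le
        · cases hr
        · have h1 := (ih C₁ α₁ _ hinv (Function.update_self _ _ _)).1 r hr
          rcases r with C₂ | ⟨C₂, α₂⟩
          · exact h1
          · obtain ⟨hsub', α₃, hα₃, hinv'⟩ := h1
            rw [Function.update_idem] at hinv'
            exact ⟨hsub.trans hsub', α₃, hα₃, hinv'⟩
    · intro C' hC hsol
      obtain ⟨r₁, hr₁, hfol⟩ := hcomp C' hC hsol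
      have hok := hsound r₁ hr₁
      rcases r₁ with C₁ | ⟨C₁, α₁⟩
      · exact ⟨.success C₁, List.mem_flatMap.2 ⟨_, hr₁, List.mem_singleton_self _⟩, trivial⟩
      · obtain ⟨hsub, hinv⟩ := hok
        by_cases hg : L ≤ (calcLambda h α₁).goal
        · refine ⟨.success C₁, List.mem_flatMap.2 ⟨_, hr₁, ?_⟩, trivial⟩
          simp [hg]
        · have hu : ¬1 - (calcLambda h α₁).fail - (calcLambda h α₁).noter < L :=
            not_lt.2 (hsol.le.trans (hinv.le_one_sub_lambda hfol))
          obtain ⟨r, hr, hr'⟩ := (ih C₁ α₁ _ hinv (Function.update_self _ _ _)).2 C' hfol hsol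
          refine ⟨r, List.mem_flatMap.2 ⟨_, hr₁, ?_⟩, hr'⟩
          simpa [hg, hu] using hr

/-- The soundness and completeness of an AND-step that extends the history by `((q, s), p)`. -/
theorem AndSpec.of_push {h : Hist S N} {C : Ctrl A O N} {q q' : Fin N} {s : S} {p : ℝ} {a : A}
    {α : Alpha} {ρ : ℕ → List ((Fin N × S) × ℝ)} {rest : List ((Fin N × S) × ℝ)}
    (hand : AndSpec P ord c₀ L (h ++ [((q, s), p)])) (hI : Inv P c₀ C h α ρ)
    (hρ : ρ h.length = ((q, s), p) :: rest) (hC : C q (P.env.Ω s) = some (.act a, q')) :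
    (∀ r ∈ andStep P ord L C q' (nextStates ord s a) (h ++ [((q, s), p)]) (α.push h.length),
      r.Ok P c₀ L fun C' α' =>
        C.IsSub C' ∧ Inv P c₀ C' h α' (Function.update ρ h.length rest)) ∧
    ∀ C', C.IsSub C' → IsSolution P c₀ L C' →
      ∃ r ∈ andStep P ord L C q' (nextStates ord s a) (h ++ [((q, s), p)]) (α.push h.length),
        r.Follows C' := by
  have hlen : (h ++ [((q, s), p)]).length = h.length + 1 := by simp
  obtain ⟨hsound, hcomp⟩ := hand C q' (nextStates ord s a) _ _ (hI.push ord hρ hC)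
    (by rw [hlen, Function.update_self]; rfl)
  refine ⟨fun r hr => ?_, hcomp⟩
  have hok := hsound r hr
  rcases r with C₁ | ⟨C₁, α₁⟩
  · exact hok
  · obtain ⟨hsub, α₂, rfl, hinv⟩ := hok
    rw [hlen, Function.update_idem] at hinv
    -- The two pending lists differ only at the level that has just been removed.
    refine ⟨hsub, (hinv.pop (Function.update_self _ _ _)).congr fun k hk => ?_⟩
    rw [Function.update_of_ne (by omega)]

theorem orSpec_of_andSpec {h : Hist S N}
    (hand : ∀ c p, c ∉ h.states → AndSpec P ord c₀ L (h ++ [(c, p)])) : OrSpec P ord c₀ L h := by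
  classical
  intro C q s p α ρ rest hI hρ
  rw [orStep]
  split_ifs with hmem
  · refine ⟨?_, fun C' hC _ => ⟨_, List.mem_singleton_self _, hC⟩⟩
    simp only [List.mem_singleton, forall_eq]
    exact ⟨Ctrl.IsSub.refl C, hI.addLoop hρ hmem⟩
  · have hand := fun p => hand (q, s) p hmem
    rcases hC : C q (P.env.Ω s) with _ | ⟨a | _, q'⟩
    · dsimp only
      constructor
      · intro r hr
        obtain ⟨⟨x, q'⟩, -, hr⟩ := List.mem_flatMap.1 hr
        have hsub := Ctrl.isSub_extend hC (x, q')
        have hself := Ctrl.extend_self C q (P.env.Ω s) (x, q')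
        rcases x with a | _
        · have hok := (AndSpec.of_push (hand p) (hI.mono hsub) hρ hself).1 r hr
          rcases r with C₁ | ⟨C₁, α₁⟩
          · exact hok
          · exact ⟨hsub.trans hok.1, hok.2⟩
        · rw [List.mem_singleton.1 hr]
          exact ⟨hsub, (hI.mono hsub).addStop hρ hself⟩
      · intro C' hCC' hsol
        -- Totality of the solution provides a transition to copy here; it is among the listed
        -- choices.
        obtain ⟨⟨x, q'⟩, hx⟩ := Option.ne_none_iff_exists'.1 (hsol.total q (P.env.Ω s))
        have hsub := Ctrl.isSub_extend hC (x, q')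
        have hself := Ctrl.extend_self C q (P.env.Ω s) (x, q')
        have hext := hCC'.extend hx
        have hch := ord.mem_choices C q (P.env.Ω s) (x, q')
        rcases x with a | _
        · obtain ⟨r, hr, hfol⟩ :=
            (AndSpec.of_push (hand p) (hI.mono hsub) hρ hself).2 C' hext hsol
          exact ⟨r, List.mem_flatMap.2 ⟨_, hch, hr⟩, hfol⟩
        · exact ⟨.done _ _, List.mem_flatMap.2 ⟨_, hch, List.mem_singleton_self _⟩, hext⟩
    · exact AndSpec.of_push (hand p) hI hρ hC
    · refine ⟨?_, fun C' hC _ => ⟨_, List.mem_singleton_self _, hC⟩⟩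
      simp only [List.mem_singleton, forall_eq]
      exact ⟨Ctrl.IsSub.refl C, hI.addStop hρ hC⟩

/-- The mutual recursion is closed by induction on its termination measure: an action is simulated
only after a new combined state has joined the history. -/
theorem orSpec (h : Hist S N) : OrSpec P ord c₀ L h := by
  induction hu : unvisited h using Nat.strong_induction_on generalizing h with
  | _ u ih =>
    exact orSpec_of_andSpec fun c p hc =>
      (ih _ (hu ▸ unvisited_append_lt h c p hc) _ rfl).andSpec

theorem andSpec (h : Hist S N) : AndSpec P ord c₀ L h := (orSpec h).andSpec

-- The root of the search

theorem inv_init (P : PlanningProblem S A O) (c₀ : Fin N × S) :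
    Inv P c₀ (Ctrl.empty : Ctrl A O N) [] Alpha.zero fun _ => [(c₀, 1)] := by
  constructor
  · simp [Alpha.zero]
  · simp [Alpha.zero]
  · simp [Alpha.zero]
  · simp [Alpha.zero]
  · simp
  · simp
  · intro w ε f _
    constructor <;> simp [Alpha.reward, Alpha.zero]
  · simp [Alpha.zero]
  · simp

/-- At the end of a complete search the bounds on the likelihood of goal termination coincide. -/
theorem Inv.lambda_eq_of_root {C : Ctrl A O N} {α : Alpha} {ρ : ℕ → List ((Fin N × S) × ℝ)}
    (hI : Inv P c₀ C [] α ρ) (hρ : ρ 0 = []) :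
    1 - (calcLambda ([] : Hist S N) α).fail - (calcLambda ([] : Hist S N) α).noter
      = (calcLambda ([] : Hist S N) α).goal := by
  have := hI.root_mass
  simp [hρ] at this
  simp [calcLambda, lambdaAfter]
  linarith

/-- The root has a single next state, so after its OR-step nothing is pending. If that step has not
succeeded already, `λ_goal` equals the upper bound, which is at least the likelihood of the
solution, and the first test returns the controller. -/
theorem exists_success (hN : 0 < N) {C' : Ctrl A O N}
    (hsol : IsSolution P (⟨0, hN⟩, P.s₀) L C') :
    ∃ C, .success C ∈ andStep P ord L Ctrl.empty ⟨0, hN⟩ [(P.s₀, 1)] [] Alpha.zero := by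
  have hempty : (Ctrl.empty : Ctrl A O N).IsSub C' := fun _ _ _ h => by cases h
  obtain ⟨hsound, hcomp⟩ := orSpec (P := P) (ord := ord) (L := L) [] Ctrl.empty ⟨0, hN⟩ P.s₀ 1
    Alpha.zero _ [] (inv_init P (⟨0, hN⟩, P.s₀)) rfl
  obtain ⟨r, hr, hfol⟩ := hcomp C' hempty hsol
  have hok := hsound r hr
  rw [andStep]
  rcases r with C₁ | ⟨C₁, α₁⟩
  · exact ⟨C₁, List.mem_flatMap.2 ⟨_, hr, List.mem_singleton_self _⟩⟩
  · have hle := hok.2.le_one_sub_lambda hfol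
    rw [hok.2.lambda_eq_of_root (Function.update_self _ _ _)] at hle
    refine ⟨C₁, List.mem_flatMap.2 ⟨_, hr, ?_⟩⟩
    simp [hsol.le.trans hle]

theorem success_sound (hN : 0 < N) {C : Ctrl A O N}
    (hC : .success C ∈ andStep P ord L Ctrl.empty ⟨0, hN⟩ [(P.s₀, 1)] [] Alpha.zero) :
    L ≤ discounted P C 1 (⟨0, hN⟩, P.s₀) :=
  (andSpec [] Ctrl.empty ⟨0, hN⟩ [(P.s₀, 1)] Alpha.zero _ (inv_init P (⟨0, hN⟩, P.s₀)) rfl).1 _ hC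

end

end Pandor

-- Soundness and completeness of the search

theorem theorem3 {S A O : Type*} [Fintype S] [Fintype A] [Fintype O]
    (P : PlanningProblem S A O) (N : ℕ) (hN : 0 < N)
    (LGTstar : ℝ) (hLGT : LGTstar ∈ Set.Ioo (0 : ℝ) 1) (ord : Pandor.SearchOrder P N) :
    (∀ C : FSC A O, Pandor.synth P N hN LGTstar ord = some C →
      C.IsBounded N ∧ ENNReal.ofReal LGTstar ≤ C.LGT P) ∧
    ((∃ C : FSC A O, C.IsBounded N ∧ ENNReal.ofReal LGTstar ≤ C.LGT P) →
      ∃ C : FSC A O, Pandor.synth P N hN LGTstar ord = some C ∧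
        C.IsBounded N ∧ ENNReal.ofReal LGTstar ≤ C.LGT P) := by
  have hsound : ∀ C : FSC A O, Pandor.synth P N hN LGTstar ord = some C →
      C.IsBounded N ∧ ENNReal.ofReal LGTstar ≤ C.LGT P := by
    intro C hC
    obtain ⟨r, hr, hrC⟩ := List.exists_of_findSome?_eq_some hC
    rcases r with C₁ | ⟨C₁, α₁⟩
    · obtain rfl := Option.some.inj hrC
      refine ⟨le_refl N, ?_⟩
      rw [Pandor.LGT_toFSC_eq_discounted]
      exact ENNReal.ofReal_le_ofReal (Pandor.success_sound hN hr)
    · cases hrC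
  refine ⟨hsound, ?_⟩
  rintro ⟨C, hCN, hC⟩
  -- The given controller may be partial and have fewer than `N` states; its completion by stops is
  -- total, has exactly `N` states and at least the same likelihood.
  have hsol : Pandor.IsSolution P (⟨0, hN⟩, P.s₀) LGTstar (Pandor.ofFSC C hN hCN) := by
    refine ⟨Pandor.ofFSC_ne_none C hN hCN, ?_⟩
    have hle := hC.trans (Pandor.LGT_le_LGT_ofFSC C hN hCN P)
    rw [Pandor.LGT_toFSC_eq_discounted] at hle
    exact (ENNReal.ofReal_le_ofReal_iff
      (Pandor.discounted_nonneg P _ zero_le_one _)).1 hle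
  obtain ⟨C₁, hC₁⟩ := Pandor.exists_success (ord := ord) hN hsol
  -- The returned controller `C₂` need not be `C₁`, as an earlier branch may succeed; that it is
  -- good enough follows from soundness.
  rcases hsy : Pandor.synth P N hN LGTstar ord with _ | C₂
  · rw [Pandor.synth, List.findSome?_eq_none_iff] at hsy
    cases hsy _ hC₁
  · exact ⟨C₂, rfl, hsound C₂ hsy⟩
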